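/- Let $\mathbb T^n=\mathbb R^n/\mathbb Z^n$ with normalized Haar measure, let $\hat f_\nu=\int_{\mathbb T^n}f(x)e^{-2\pi i\nu\cdot x}\,dx$ $(\nu\in\mathbb Z^n)$ be the Fourier coefficients of $f\in L^1(\mathbb T^n)$, and let $L^1_+(\mathbb T^n)=\{f\in L^1(\mathbb T^n):\hat f_\nu\ge 0\text{ for all }\nu\in\mathbb Z^n\}$. For $D\subset\mathbb T^n$ of positive measure $|D|$, put $$W_n(D)=\sup_{f\in L^1_+(\mathbb T^n)\setminus\{0\}}\frac{\int_{\mathbb T^n}|f|^2\,dx}{|D|^{-1}\int_D|f|^2\,dx}\in[0,\infty],$$ where functions for which both integrals are infinite are disregarded, and a quotient with only the numerator infinite, or with denominator zero, is counted as $\infty$. Let $a_{\mathbb T}([-\delta,\delta])$ be the periodic Turán constant, that is, the supremum of $\hat g_0$ over all continuous $g:\mathbb T\to\mathbb C$ with $\hat g_\nu\ge 0$ for all $\nu\in\mathbb Z$, $\operatorname{supp} g\subset[-\delta,\delta]$ and $g(0)=1$. Let $I^n=[-1,1]^n$ and define $$\theta(\delta)=1-\frac{\delta}{a_{\mathbb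 T}([-\delta,\delta])},\qquad \delta\in(0,1/2).$$ **Theorem.** For every integer $n\ge1$ and every $\delta\in(0,1/2)$, $$W_n(\delta I^n)\le 2^n\bigl(1-\theta(\delta)\bigr)^n .$$ Moreover: (i) $\theta$ is continuous on $(0,1/2)$, and $\theta(\delta)=O(\delta^2)$ as $\delta\to0^+$; (ii) $\theta(\delta)=0$ for every $\delta\in(0,1/2)$ with $1/\delta\in\mathbb N$; (iii) $0<\theta(\delta)<1$ for every $\delta\in(0,1/2)$ with $1/\delta\notin\mathbb N$. -/

import Mathlib

open MeasureTheory Filter Topology Set Asymptotics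
open scoped ENNReal ComplexOrder

noncomputable section

namespace WienerTuran

/-- The torus `𝕋ⁿ = ℝⁿ / ℤⁿ`. Its `volume` is the Haar probability measure. -/
abbrev Torus (n : ℕ) : Type := UnitAddTorus (Fin n)

/-- The projection `ℝⁿ → 𝕋ⁿ`. -/
def torusProj (n : ℕ) (x : Fin n → ℝ) : Torus n := fun i => (x i : UnitAddCircle)

/-- The cube `δ Iⁿ = [-δ, δ]ⁿ`, regarded as a subset of `𝕋ⁿ`. -/
def torusCube (n : ℕ) (δ : ℝ) : Set (Torus n) :=
  torusProj n '' {x : Fin n → ℝ | ∀ i, x i ∈ Icc (-δ) δ}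

/-- `f ∈ L¹₊(𝕋ⁿ)`: `f` is integrable and all its Fourier coefficients
are (real and) nonnegative. -/
def IsL1Plus {n : ℕ} (f : Torus n → ℂ) : Prop :=
  Integrable f volume ∧ ∀ ν : Fin n → ℤ, 0 ≤ UnitAddTorus.mFourierCoeff f ν

/-- The sharp constant `W_n(D)` in Wiener's problem: the supremum over nonzero `f ∈ L¹₊(𝕋ⁿ)` of
`∫_{𝕋ⁿ} |f|²` divided by `|D|⁻¹ ∫_D |f|²`. The quotient is taken in `[0, ∞]`; it is `∞` when the
numerator is infinite and the denominator is finite, and also when a positive number is divided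
by zero, while the indeterminate `∞ / ∞` has the value `0` and so does not affect the
supremum. -/
def wienerConst (n : ℕ) (D : Set (Torus n)) : ℝ≥0∞ :=
  ⨆ (f : Torus n → ℂ) (_ : IsL1Plus f) (_ : ¬ f =ᵐ[volume] 0),
    (∫⁻ x, ‖f x‖ₑ ^ 2) / ((volume D)⁻¹ * ∫⁻ x in D, ‖f x‖ₑ ^ 2)

/-- Admissible functions of the periodic Turán problem for `D`: positive definite functions
supported in `D` with value `1` at the origin. -/
def IsTuranAdmissible {n : ℕ} (D : Set (Torus n)) (g : C(Torus n, ℂ)) : Prop :=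
  (∀ ν : Fin n → ℤ, 0 ≤ UnitAddTorus.mFourierCoeff g ν) ∧ tsupport g ⊆ D ∧ g 0 = 1

/-- The periodic Turán constant `a_{𝕋ⁿ}(D)`: the supremum of the zeroth Fourier coefficient over
all admissible functions. -/
def turanConst (n : ℕ) (D : Set (Torus n)) : ℝ :=
  sSup {a : ℝ | ∃ g : C(Torus n, ℂ), IsTuranAdmissible D g ∧
    a = (UnitAddTorus.mFourierCoeff g 0).re}

/-- `θ(δ) = 1 - δ / a_𝕋([-δ, δ])`. -/
def theta (δ : ℝ) : ℝ := 1 - δ / turanConst 1 (torusCube 1 δ)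

end WienerTuran

end

open AddCircle

noncomputable section

namespace WienerTuran

/-! Let `g` be admissible for the Turán problem on `[-δ, δ]`, and let `F` be integrable on the torus
with nonnegative coefficients. The coefficients of `F(x) ∏ g(x_i)` are convolutions of nonnegative
sequences, so keeping a single term bounds them below by `ĝ₀ⁿ F̂_ν`. For `F = f` this shows that `f`
is in `L²` once it is so on the cube (Wiener's theorem). For `F = |f|²` and `ν = 0`, together with
`|g| ≤ g(0) = 1`, it gives `ĝ₀ⁿ ∫ |f|² ≤ ∫_{δIⁿ} |f|²`. Taking the supremum over `g` and inserting
`|δIⁿ| = (2δ)ⁿ` bounds `W_n` by `(2δ / a)ⁿ`, where `a = a(δ)` is the Turán constant.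

The rest concerns `a(δ)` alone. The tent function gives `a ≥ δ`. Averaging over the subgroup of
order `q` gives `a ≤ 1/q` whenever `δ ≤ 1/q`, so `θ(1/q) = 0`. For small `δ`, multiplication by
Wendland's function turns an admissible function into a positive definite function on the line,
where the Turán bound is `δ`; since Wendland's function is `1 + O(y²)`, the error is `O(δ³)`.

If `1/δ` is not an integer, the tent is not extremal: one adds a small multiple of a function that
vanishes at `0` and has positive mean. Its negative coefficients must be absorbed by those of the
tent. For irrational `δ` the latter never vanish and only finitely many are needed; for rational `δ`
the perturbation is built to have negative coefficients only where the tent's are comparably large.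

Finally `a` is monotone, so continuity needs one estimate on each side: compactness of coefficient
sequences on the right, and on the left a small inward displacement of the two ends of the support,
repaired by a small positive definite correction. -/

/-! ### Fourier coefficients of continuous functions on the circle. -/

/-- The `ν`-th Fourier coefficient as a continuous linear functional on `C(𝕋, ℂ)`. -/
def coeffL (ν : ℤ) : C(UnitAddCircle, ℂ) →L[ℂ] ℂ :=
  LinearMap.mkContinuous
    { toFun := fun f => fourierCoeff f ν
      map_add' := fun f g => congrFun (fourierCoeff.add
        (f.continuous.integrable_of_hasCompactSupport (HasCompactSupport.of_compactSpace _))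
        (g.continuous.integrable_of_hasCompactSupport (HasCompactSupport.of_compactSpace _))) ν
      map_smul' := fun c f => fourierCoeff.const_smul f c ν } 1 (by
      intro f
      have := norm_integral_le_of_norm_le_const (μ := haarAddCircle (T := 1))
        (f := fun t : UnitAddCircle => fourier (-ν) t • f t) (C := ‖f‖)
        (ae_of_all _ fun x => by
          simpa [norm_smul, -fourier_apply, fourier_apply, Circle.norm_coe] using f.norm_coe_le_norm x)
      simpa [fourierCoeff] using this)

theorem coeffL_apply (ν : ℤ) (f : C(UnitAddCircle, ℂ)) : coeffL ν f = fourierCoeff f ν := rfl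

theorem coeffL_fourier_mul (m ν : ℤ) (f : C(UnitAddCircle, ℂ)) :
    coeffL ν (fourier m * f) = coeffL (ν - m) f := by
  simp only [coeffL_apply, fourierCoeff, ContinuousMap.mul_apply, smul_eq_mul, ← mul_assoc,
    ← fourier_add]
  congr! 4; ring_nf

theorem coeffL_fourier (m ν : ℤ) : coeffL ν (fourier m) = if ν = m then 1 else 0 := by
  rw [coeffL_apply, fourierCoeff_fourier, Pi.single_apply]

/-- The translate `x ↦ f (x + t)`. -/
def shift (t : UnitAddCircle) (f : C(UnitAddCircle, ℂ)) : C(UnitAddCircle, ℂ) :=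
  ⟨fun x => f (x + t), by fun_prop⟩

@[simp] theorem shift_apply (t : UnitAddCircle) (f : C(UnitAddCircle, ℂ)) (x) :
    shift t f x = f (x + t) := rfl

theorem fourier_apply_add (ν : ℤ) (x y : UnitAddCircle) :
    fourier ν (x + y) = fourier ν x * fourier ν y := by
  simp [fourier_apply, smul_add, toCircle_add]

theorem fourier_mul_neg (ν : ℤ) (x : UnitAddCircle) : fourier ν x * fourier (-ν) x = 1 := by
  rw [← fourier_add]; simp

theorem coeffL_shift (t : UnitAddCircle) (ν : ℤ) (f : C(UnitAddCircle, ℂ)) :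
    coeffL ν (shift t f) = fourier ν t * coeffL ν f := by
  simp only [coeffL_apply, fourierCoeff, smul_eq_mul, shift_apply]
  rw [← integral_const_mul,
    ← integral_add_right_eq_self (μ := haarAddCircle) (fun x => fourier ν t * _) t]
  refine integral_congr_ae (ae_of_all _ fun x => ?_)
  have h := fourier_mul_neg ν t
  simp only [fourier_apply_add]
  linear_combination (-(fourier (-ν) x * f (x + t))) * h

/-- The function `x ↦ (f x + conj (f (-x))) / 2`, whose Fourier coefficients are the real parts of
those of `f`. -/
def hermitianPart (f : C(UnitAddCircle, ℂ)) : C(UnitAddCircle, ℂ) :=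
  ⟨fun x => (f x + (starRingEnd ℂ) (f (-x))) / 2, by fun_prop⟩

theorem hermitianPart_apply (f : C(UnitAddCircle, ℂ)) (x) :
    hermitianPart f x = (f x + (starRingEnd ℂ) (f (-x))) / 2 := rfl

theorem coeffL_hermitianPart (ν : ℤ) (f : C(UnitAddCircle, ℂ)) :
    coeffL ν (hermitianPart f) = ((coeffL ν f).re : ℂ) := by
  let g : C(UnitAddCircle, ℂ) := ⟨fun x => (starRingEnd ℂ) (f (-x)), by fun_prop⟩
  have hg : coeffL ν g = (starRingEnd ℂ) (coeffL ν f) := by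
    simp only [coeffL_apply, fourierCoeff, smul_eq_mul, ← integral_conj, map_mul]
    rw [← integral_neg_eq_self]
    refine integral_congr_ae (ae_of_all _ fun x => ?_)
    simp [g]
  have : hermitianPart f = (1 / 2 : ℂ) • (f + g) := by
    ext x; simp [hermitianPart, g]; ring
  rw [this, map_smul, map_add, hg, Complex.add_conj]
  simp

/-- **Fejér**: nonnegative Fourier coefficients of a continuous function are summable. -/
theorem summable_coeffL {f : C(UnitAddCircle, ℂ)} (hf : ∀ ν, 0 ≤ coeffL ν f) :
    Summable fun ν => coeffL ν f := by
  -- With `S` the exponential sum over `F`, the double sum is `∫ |S|² f`, which is at most `‖f‖ ∫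
  -- |S|² = ‖f‖ · card F`.
  have key : ∀ F : Finset ℤ, ∑ j ∈ F, ∑ k ∈ F, (coeffL (j - k) f).re ≤ ‖f‖ * F.card := by
    intro F
    let S : C(UnitAddCircle, ℂ) := ∑ k ∈ F, fourier k
    let P : C(UnitAddCircle, ℂ) := star S * S
    have hP : P = ∑ j ∈ F, ∑ k ∈ F, fourier (k - j) := by
      ext x
      simp only [P, S, Finset.sum_mul_sum, sub_eq_add_neg, ContinuousMap.mul_apply,
        ContinuousMap.star_apply, ContinuousMap.sum_apply, star_sum, fourier_add, fourier_neg]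
      exact Finset.sum_congr rfl fun j _ => Finset.sum_congr rfl fun k _ => mul_comm _ _
    have h1 : ∑ j ∈ F, ∑ k ∈ F, coeffL (j - k) f = coeffL 0 (P * f) := by
      rw [hP]
      simp [Finset.sum_mul, coeffL_fourier_mul]
    have h2 : coeffL 0 P = F.card := by
      rw [hP]
      simp only [map_sum, coeffL_fourier]
      rw [Finset.sum_congr rfl (g := fun j => (1 : ℂ))]
      · simp
      intro j hj
      rw [Finset.sum_eq_single_of_mem j hj]
      · simp
      · intro k _ hk
        rw [if_neg]; intro h; exact hk (by linarith)
    have hPx : ∀ x, P x = ((‖S x‖ ^ 2 : ℝ) : ℂ) := by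
      intro x
      simp [P, ← Complex.conj_mul']
    have h3 : ‖coeffL 0 (P * f)‖ ≤ ‖f‖ * F.card := by
      have h4 : coeffL 0 P = ((∫ x, ‖S x‖ ^ 2 ∂haarAddCircle : ℝ) : ℂ) := by
        rw [coeffL_apply, fourierCoeff, ← integral_complex_ofReal]
        simp [hPx]
      rw [h2] at h4
      have h5 : (F.card : ℝ) = ∫ x, ‖S x‖ ^ 2 ∂haarAddCircle := by exact_mod_cast h4
      rw [h5, ← integral_const_mul, coeffL_apply, fourierCoeff]
      refine norm_integral_le_of_norm_le ?_ (ae_of_all _ fun x => ?_)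
      · exact Continuous.integrable_of_hasCompactSupport (by fun_prop)
          (HasCompactSupport.of_compactSpace _)
      · simp only [neg_zero, fourier_zero, one_smul, ContinuousMap.mul_apply, hPx, norm_mul,
          Complex.norm_real, norm_pow, norm_norm]
        rw [mul_comm]
        gcongr
        exact f.norm_coe_le_norm x
    have h6 := (Complex.re_le_norm _).trans h3
    rw [← h1] at h6
    simpa using h6
  have hre : ∀ ν, 0 ≤ (coeffL ν f).re := fun ν => (Complex.le_def.1 (hf ν)).1
  have hs : Summable fun ν => (coeffL ν f).re := by
    refine summable_of_sum_le (c := 4 * ‖f‖) hre fun u => ?_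
    obtain ⟨K, hK1, hK⟩ : ∃ K : ℕ, 1 ≤ K ∧ ∀ ν ∈ u, |ν| ≤ (K : ℤ) := by
      refine ⟨u.sup (fun ν => ν.natAbs) + 1, by omega, fun ν hν => ?_⟩
      have : ν.natAbs ≤ _ := Finset.le_sup (f := fun ν : ℤ => ν.natAbs) hν
      rw [Int.abs_eq_natAbs]
      omega
    -- For `u ⊆ [-K, K]`, each of the `K` translates `u + k`, `0 ≤ k < K`, fits into this interval,
    -- whose `3K + 1 ≤ 4K` points cost only a constant factor.
    let F : Finset ℤ := Finset.Icc (-K) (2 * K)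
    have hF : (F.card : ℝ) ≤ 4 * K := by
      have : F.card ≤ 4 * K := by simp [F]; omega
      exact_mod_cast this
    have h1 : ∑ k ∈ Finset.Ico (0 : ℤ) K, ∑ ν ∈ u, (coeffL ν f).re
        ≤ ∑ k ∈ F, ∑ j ∈ F, (coeffL (j - k) f).re := by
      refine (Finset.sum_le_sum fun k hk => ?_).trans (Finset.sum_le_sum_of_subset_of_nonneg
        (t := F) (fun k hk => ?_) fun k _ _ => Finset.sum_nonneg fun j _ => hre _)
      · have : ∑ ν ∈ u, (coeffL ν f).re = ∑ j ∈ u.image (· + k), (coeffL (j - k) f).re := by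
          rw [Finset.sum_image (by intro a _ b _ h; simpa using h)]
          simp
        rw [this]
        refine Finset.sum_le_sum_of_subset_of_nonneg (fun j hj => ?_) fun _ _ _ => hre _
        obtain ⟨ν, hν, rfl⟩ := Finset.mem_image.1 hj
        have := abs_le.1 (hK ν hν)
        simp [F] at hk ⊢
        omega
      · simp [F] at hk ⊢; omega
    have h2 := h1.trans ((Finset.sum_comm).trans_le (key F))
    simp only [Finset.sum_const, Int.card_Ico, sub_zero, Int.toNat_natCast, nsmul_eq_mul] at h2
    have hK' : (0 : ℝ) < K := by exact_mod_cast hK1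
    have := mul_le_mul_of_nonneg_left hF (norm_nonneg f)
    nlinarith
  have := Complex.hasSum_ofReal.2 hs.hasSum
  refine this.summable.congr fun ν => ?_
  exact (Complex.eq_re_of_ofReal_le (r := 0) (by simpa using hf ν)).symm

/-! ### The Turán problem transferred to the circle. -/

theorem norm_coe_of_abs_le {y : ℝ} (hy : |y| ≤ 1 / 2) : ‖(y : UnitAddCircle)‖ = |y| :=
  (AddCircle.norm_coe_eq_abs_iff 1 one_ne_zero).2 (by simpa using hy)

theorem norm_le_half (x : UnitAddCircle) : ‖x‖ ≤ 1 / 2 := by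
  simpa using AddCircle.norm_le_half_period 1 (x := x) one_ne_zero

theorem exists_coe_abs_eq_norm (x : UnitAddCircle) : ∃ y : ℝ, (y : UnitAddCircle) = x ∧ |y| = ‖x‖ := by
  obtain ⟨y, rfl⟩ := QuotientAddGroup.mk_surjective x
  refine ⟨y - round y, ?_, (UnitAddCircle.norm_eq).symm⟩
  have : ((round y : ℝ) : UnitAddCircle) = 0 := by
    rw [AddCircle.coe_eq_zero_iff]; exact ⟨round y, by simp⟩
  rw [AddCircle.coe_sub, this, sub_zero]

theorem mem_torusCube {n : ℕ} {δ : ℝ} (hδ : δ < 1 / 2) (x : Torus n) :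
    x ∈ torusCube n δ ↔ ∀ i, ‖x i‖ ≤ δ := by
  constructor
  · rintro ⟨y, hy, rfl⟩ i
    have h : |y i| ≤ δ := abs_le.2 (hy i)
    exact (norm_coe_of_abs_le (h.trans hδ.le)).trans_le h
  · intro h
    choose y hy1 hy2 using fun i => exists_coe_abs_eq_norm (x i)
    exact ⟨y, fun i => abs_le.1 ((hy2 i).trans_le (h i)), funext hy1⟩

theorem isClosed_torusCube {n : ℕ} {δ : ℝ} (hδ : δ < 1 / 2) : IsClosed (torusCube n δ) := by
  have : torusCube n δ = ⋂ i, {x | ‖x i‖ ≤ δ} := by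
    ext x; simp [mem_torusCube hδ]
  rw [this]
  exact isClosed_iInter fun i => isClosed_le (by fun_prop) continuous_const

theorem volume_eq_haarAddCircle : (volume : Measure UnitAddCircle) = haarAddCircle := by
  rw [AddCircle.volume_eq_smul_haarAddCircle]; simp

theorem pi_haarAddCircle (n : ℕ) :
    Measure.pi (fun _ : Fin n => haarAddCircle (T := 1)) = (volume : Measure (Torus n)) := by
  rw [volume_pi, volume_eq_haarAddCircle]

theorem mFourierCoeff_eq_integral_volume {n : ℕ} (f : Torus n → ℂ) (ν : Fin n → ℤ) :
    UnitAddTorus.mFourierCoeff f ν = ∫ x, UnitAddTorus.mFourier (-ν) x * f x := by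
  rw [← pi_haarAddCircle]; rfl

theorem mFourierCoeff_fin_one (f : UnitAddCircle → ℂ) (ν : Fin 1 → ℤ) :
    UnitAddTorus.mFourierCoeff (fun x : Torus 1 => f (x 0)) ν = fourierCoeff f (ν 0) := by
  rw [mFourierCoeff_eq_integral_volume, ← pi_haarAddCircle, fourierCoeff]
  rw [← (measurePreserving_funUnique (haarAddCircle (T := 1)) (Fin 1)).integral_comp
    (MeasurableEquiv.measurableEmbedding _)]
  refine integral_congr_ae (ae_of_all _ fun x => ?_)
  simp [UnitAddTorus.mFourier, MeasurableEquiv.funUnique]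

/-- Multiples of admissible functions for the Turán problem on the circle, up to symmetrization. -/
structure Feasible (δ : ℝ) (f : C(UnitAddCircle, ℂ)) : Prop where
  re_nonneg : ∀ ν, 0 ≤ (coeffL ν f).re
  eq_zero : ∀ x, δ < ‖x‖ → f x = 0

theorem hasSum_coeffL_apply {f : C(UnitAddCircle, ℂ)} (hf : Summable fun ν => coeffL ν f) (x) :
    HasSum (fun ν => coeffL ν f * fourier ν x) (f x) :=
  has_pointwise_sum_fourier_series_of_summable hf x

theorem Feasible.summable {δ : ℝ} {f : C(UnitAddCircle, ℂ)} (hf : Feasible δ f) :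
    Summable fun ν => (coeffL ν f).re := by
  have h : ∀ ν, 0 ≤ coeffL ν (hermitianPart f) := fun ν => by
    rw [coeffL_hermitianPart]; exact_mod_cast hf.re_nonneg ν
  simpa [coeffL_hermitianPart] using (Complex.hasSum_re (summable_coeffL h).hasSum).summable

/-- Evaluate at `0` the Fourier series of the Hermitian part, which converges absolutely by Fejér's
theorem. Consequently no coefficient exceeds the value at `0`. -/
theorem Feasible.hasSum {δ : ℝ} {f : C(UnitAddCircle, ℂ)} (hf : Feasible δ f) :
    HasSum (fun ν => (coeffL ν f).re) (f 0).re := by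
  have h : ∀ ν, 0 ≤ coeffL ν (hermitianPart f) := fun ν => by
    rw [coeffL_hermitianPart]; exact_mod_cast hf.re_nonneg ν
  have := Complex.hasSum_re (hasSum_coeffL_apply (summable_coeffL h) 0)
  simpa [coeffL_hermitianPart, hermitianPart_apply, Complex.add_conj] using this

theorem Feasible.apply_nonneg {δ : ℝ} {f : C(UnitAddCircle, ℂ)} (hf : Feasible δ f) :
    0 ≤ (f 0).re := hf.hasSum.nonneg hf.re_nonneg

theorem Feasible.coeff_le {δ : ℝ} {f : C(UnitAddCircle, ℂ)} (hf : Feasible δ f) (ν : ℤ) :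
    (coeffL ν f).re ≤ (f 0).re := le_hasSum hf.hasSum ν fun j _ => hf.re_nonneg j

theorem Feasible.mono {δ δ' : ℝ} (h : δ ≤ δ') {f : C(UnitAddCircle, ℂ)} (hf : Feasible δ f) :
    Feasible δ' f := ⟨hf.re_nonneg, fun x hx => hf.eq_zero x (h.trans_lt hx)⟩

theorem IsTuranAdmissible.circle {δ : ℝ} (hδ : δ < 1 / 2) {g : C(Torus 1, ℂ)}
    (hg : IsTuranAdmissible (torusCube 1 δ) g) :
    ∃ f : C(UnitAddCircle, ℂ), (∀ ν, 0 ≤ coeffL ν f) ∧ Feasible δ f ∧ f 0 = 1 ∧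
      coeffL 0 f = UnitAddTorus.mFourierCoeff g 0 := by
  let f : C(UnitAddCircle, ℂ) := ⟨fun x => g fun _ => x, by fun_prop⟩
  have hgf : (g : Torus 1 → ℂ) = fun x => f (x 0) := by
    ext x
    simp only [f, ContinuousMap.coe_mk]
    congr 1; ext i; rw [Subsingleton.elim i 0]
  have hc : ∀ ν : ℤ, coeffL ν f = UnitAddTorus.mFourierCoeff g fun _ => ν := by
    intro ν; rw [hgf, mFourierCoeff_fin_one]; rfl
  have h0 : ∀ ν, 0 ≤ coeffL ν f := fun ν => by rw [hc]; exact hg.1 _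
  refine ⟨f, h0, ⟨fun ν => (Complex.le_def.1 (h0 ν)).1, fun x hx => ?_⟩, ?_, hc 0⟩
  · by_contra h
    have := hg.2.1 (subset_tsupport g (Function.mem_support.2 h))
    rw [mem_torusCube hδ] at this
    exact absurd (this 0) (not_le.2 hx)
  · exact hg.2.2

/-- The Hermitian part makes the coefficients real without enlarging the symmetric support; dividing
by its value at `0` normalizes it. -/
theorem exists_isTuranAdmissible {δ : ℝ} (hδ : δ < 1 / 2) {f : C(UnitAddCircle, ℂ)}
    (hf : Feasible δ f) (h0 : 0 < (f 0).re) :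
    ∃ g, IsTuranAdmissible (torusCube 1 δ) g ∧
      (UnitAddTorus.mFourierCoeff g 0).re = (coeffL 0 f).re / (f 0).re := by
  let h : C(UnitAddCircle, ℂ) := (((f 0).re : ℂ))⁻¹ • hermitianPart f
  have hh : ∀ ν, coeffL ν h = (((coeffL ν f).re / (f 0).re : ℝ) : ℂ) := by
    intro ν; simp only [h, map_smul, coeffL_hermitianPart]; push_cast; simp [field]
  let g : C(Torus 1, ℂ) := ⟨fun x => h (x 0), by fun_prop⟩
  have hg : ∀ ν, UnitAddTorus.mFourierCoeff g ν = coeffL (ν 0) h := fun ν =>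
    mFourierCoeff_fin_one h ν
  refine ⟨g, ⟨fun ν => ?_, ?_, ?_⟩, ?_⟩
  · rw [hg, hh]
    exact_mod_cast div_nonneg (hf.re_nonneg _) h0.le
  · refine closure_minimal (fun x hx => ?_) (isClosed_torusCube hδ)
    rw [mem_torusCube hδ]
    intro i
    rw [Subsingleton.elim i 0]
    by_contra! hlt
    apply hx
    simp [g, h, hermitianPart_apply, hf.eq_zero _ hlt, hf.eq_zero (-x 0) (by simpa using hlt)]
  · simp only [g, h, hermitianPart_apply, ContinuousMap.coe_mk, Pi.zero_apply,
      ContinuousMap.smul_apply, neg_zero,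
      Complex.add_conj, smul_eq_mul]
    have : ((f 0).re : ℂ) ≠ 0 := by exact_mod_cast h0.ne'
    push_cast
    field_simp
  · rw [hg]; simp [hh]

theorem bddAbove_turan {δ : ℝ} (hδ : δ < 1 / 2) :
    BddAbove {a : ℝ | ∃ g : C(Torus 1, ℂ), IsTuranAdmissible (torusCube 1 δ) g ∧
      a = (UnitAddTorus.mFourierCoeff g 0).re} := by
  refine ⟨1, ?_⟩
  rintro a ⟨g, hg, rfl⟩
  obtain ⟨f, -, hf, hf0, hfc⟩ := hg.circle hδ
  simpa [← hfc, hf0] using hf.coeff_le 0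

/-- The Turán constant of the arc `[-δ, δ]`. -/
abbrev turan (δ : ℝ) : ℝ := turanConst 1 (torusCube 1 δ)

theorem Feasible.le_turan {δ : ℝ} (hδ : δ < 1 / 2) {f : C(UnitAddCircle, ℂ)}
    (hf : Feasible δ f) : (coeffL 0 f).re ≤ turan δ * (f 0).re := by
  rcases hf.apply_nonneg.eq_or_lt with h | h
  · rw [← h, mul_zero, h]; exact hf.coeff_le 0
  · obtain ⟨g, hg, hgc⟩ := exists_isTuranAdmissible hδ hf h
    rw [← div_le_iff₀ h, ← hgc]
    exact le_csSup (bddAbove_turan hδ) ⟨g, hg, rfl⟩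

theorem turan_le {δ b : ℝ} (hδ : δ < 1 / 2) (hb : 0 ≤ b)
    (h : ∀ f : C(UnitAddCircle, ℂ), (∀ ν, 0 ≤ coeffL ν f) → Feasible δ f → f 0 = 1 →
      (coeffL 0 f).re ≤ b) : turan δ ≤ b := by
  refine Real.sSup_le ?_ hb
  rintro a ⟨g, hg, rfl⟩
  obtain ⟨f, h1, hf, hf0, hfc⟩ := hg.circle hδ
  rw [← hfc]
  exact h f h1 hf hf0

theorem exists_feasible_gt {δ b : ℝ} (hδ : δ < 1 / 2) (hb : 0 ≤ b) (h : b < turan δ) :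
    ∃ f : C(UnitAddCircle, ℂ), (∀ ν, 0 ≤ coeffL ν f) ∧ Feasible δ f ∧ f 0 = 1 ∧
      b < (coeffL 0 f).re := by
  by_contra! hc
  exact absurd h (not_lt.2 (turan_le hδ hb hc))

/-! ### Tent functions and the lower bound `δ ≤ a(δ)`. -/

open Real in
theorem coeffL_even {s : ℝ} (hs0 : 0 ≤ s) (hs : s ≤ 1 / 2) {κ : ℝ → ℝ}
    {f : C(UnitAddCircle, ℂ)} (hf : ∀ y : ℝ, |y| ≤ s → f y = κ |y|)
    (h0 : ∀ x, s < ‖x‖ → f x = 0) (ν : ℤ) :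
    coeffL ν f = ((2 * ∫ y in (0 : ℝ)..s, κ y * cos (2 * π * ν * y) : ℝ) : ℂ) := by
  rw [coeffL_apply, fourierCoeff_eq_intervalIntegral f ν (-(1 / 2))]
  let F : ℝ → ℂ := fun y => fourier (-ν) (y : UnitAddCircle) • f y
  have hF : Continuous F := by
    have : Continuous fun y : ℝ => (y : UnitAddCircle) := AddCircle.continuous_mk' 1
    fun_prop
  have hFi : ∀ a b, IntervalIntegrable F volume a b := fun a b => hF.intervalIntegrable a b
  have h1 : (∫ y in (-(1 / 2) : ℝ)..(-(1 / 2) + 1), F y) = ∫ y in (0 : ℝ)..(1 / 2), (F y + F (-y)) := by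
    have hn : Continuous fun y => F (-y) := hF.comp continuous_neg
    rw [intervalIntegral.integral_add (hFi _ _) (hn.intervalIntegrable _ _),
      intervalIntegral.integral_comp_neg (f := F), neg_zero, add_comm (∫ y in _.._, F y),
      intervalIntegral.integral_add_adjacent_intervals (hFi _ _) (hFi _ _)]
    norm_num
  have hint : ∀ a b, IntervalIntegrable (fun y => F y + F (-y)) volume a b := fun a b =>
    (hF.add (hF.comp continuous_neg)).intervalIntegrable a b
  have h2 : (∫ y in (0 : ℝ)..(1 / 2), (F y + F (-y))) = ∫ y in (0 : ℝ)..s, (F y + F (-y)) := by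
    rw [← intervalIntegral.integral_add_adjacent_intervals (hint 0 s) (hint s (1 / 2))]
    have : (∫ y in s..(1 / 2), (F y + F (-y))) = 0 := by
      refine intervalIntegral.integral_zero_ae (ae_of_all _ fun y hy => ?_)
      rw [uIoc_of_le hs] at hy
      have hy' : ‖(y : UnitAddCircle)‖ = y := by
        rw [norm_coe_of_abs_le, abs_of_nonneg (hs0.trans hy.1.le)]
        rw [abs_of_nonneg (hs0.trans hy.1.le)]; exact hy.2
      simp [F, h0 (y : UnitAddCircle) (by rw [hy']; exact hy.1),
        h0 (-(y : UnitAddCircle)) (by rw [norm_neg, hy']; exact hy.1)]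
    rw [this, add_zero]
  have h3 : (∫ y in (0 : ℝ)..s, (F y + F (-y))) =
      ∫ y in (0 : ℝ)..s, ((2 * (κ y * cos (2 * π * ν * y)) : ℝ) : ℂ) := by
    refine intervalIntegral.integral_congr fun y hy => ?_
    rw [uIcc_of_le hs0] at hy
    have hy1 : |y| = y := abs_of_nonneg hy.1
    have e1 := hf y (by rw [hy1]; exact hy.2)
    have e2 := hf (-y) (by rw [abs_neg, hy1]; exact hy.2)
    rw [abs_neg] at e2
    simp only [F, e1, e2, hy1, fourier_coe_apply, smul_eq_mul]
    push_cast
    rw [← add_mul, Complex.cos]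
    ring_nf
  simp only [F] at h1 h2 h3
  rw [h1, h2, h3, intervalIntegral.integral_ofReal, intervalIntegral.integral_const_mul]
  simp

open Real in
/-- Repeated integration by parts of a quartic polynomial against a cosine. -/
theorem integral_mul_cos {P P₁ P₂ P₃ P₄ : ℝ → ℝ} (h0 : ∀ y, HasDerivAt P (P₁ y) y)
    (h1 : ∀ y, HasDerivAt P₁ (P₂ y) y) (h2 : ∀ y, HasDerivAt P₂ (P₃ y) y)
    (h3 : ∀ y, HasDerivAt P₃ (P₄ y) y) (h4 : ∀ y, HasDerivAt P₄ 0 y) {w : ℝ} (hw : w ≠ 0)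
    (b : ℝ) :
    ∫ y in (0 : ℝ)..b, P y * cos (w * y) =
      (P b * sin (w * b) / w + P₁ b * cos (w * b) / w ^ 2 - P₂ b * sin (w * b) / w ^ 3
        - P₃ b * cos (w * b) / w ^ 4 + P₄ b * sin (w * b) / w ^ 5)
      - (P₁ 0 / w ^ 2 - P₃ 0 / w ^ 4) := by
  have hP : Continuous P := continuous_iff_continuousAt.2 fun y => (h0 y).continuousAt
  have key : ∀ y, HasDerivAt (fun y => P y * sin (w * y) / w + P₁ y * cos (w * y) / w ^ 2
      - P₂ y * sin (w * y) / w ^ 3 - P₃ y * cos (w * y) / w ^ 4 + P₄ y * sin (w * y) / w ^ 5)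
      (P y * cos (w * y)) y := by
    intro y
    have hl : HasDerivAt (fun y => w * y) w y := by simpa using (hasDerivAt_id y).const_mul w
    have hs := hl.sin
    have hc := hl.cos
    have := ((((((h0 y).mul hs).div_const w).add (((h1 y).mul hc).div_const (w ^ 2))).sub
      (((h2 y).mul hs).div_const (w ^ 3))).sub (((h3 y).mul hc).div_const (w ^ 4))).add
      (((h4 y).mul hs).div_const (w ^ 5))
    refine this.congr_deriv ?_
    field_simp
    ring
  rw [intervalIntegral.integral_eq_sub_of_hasDerivAt (fun y _ => key y)
    (by apply Continuous.intervalIntegrable; fun_prop)]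
  simp

/-- The tent function `x ↦ max (0, s - ‖x‖)` on the circle. -/
def tent (s : ℝ) : C(UnitAddCircle, ℂ) := ⟨fun x => ((max 0 (s - ‖x‖) : ℝ) : ℂ), by fun_prop⟩

theorem tent_apply (s : ℝ) (x : UnitAddCircle) : tent s x = ((max 0 (s - ‖x‖) : ℝ) : ℂ) := rfl

theorem tent_zero {s : ℝ} (hs : 0 ≤ s) : tent s 0 = s := by simp [tent_apply, hs]

theorem tent_eq_zero {s : ℝ} {x : UnitAddCircle} (hx : s ≤ ‖x‖) : tent s x = 0 := by
  simp [tent_apply, hx]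

open Real in
/-- The Fourier coefficients of the tent function. -/
def tentCoeff (s : ℝ) (ν : ℤ) : ℝ := if ν = 0 then s ^ 2 else (sin (π * ν * s) / (π * ν)) ^ 2

theorem tentCoeff_nonneg (s : ℝ) (ν : ℤ) : 0 ≤ tentCoeff s ν := by
  unfold tentCoeff; split_ifs <;> positivity

@[simp] theorem tentCoeff_zero (s : ℝ) : tentCoeff s 0 = s ^ 2 := by simp [tentCoeff]

open Real in
theorem coeffL_tent {s : ℝ} (hs0 : 0 ≤ s) (hs : s ≤ 1 / 2) (ν : ℤ) :
    coeffL ν (tent s) = (tentCoeff s ν : ℂ) := by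
  rw [coeffL_even (κ := fun y => s - y) hs0 hs (fun y hy => ?_)
    (fun x hx => tent_eq_zero hx.le)]
  · congr 1
    unfold tentCoeff
    split_ifs with hν
    · subst hν
      have : ∫ y in (0 : ℝ)..s, (s - y) = s * s - s ^ 2 / 2 := by
        rw [intervalIntegral.integral_sub (by simp) (by simp)]
        simp
      simp [this]
      ring
    · have hν' : (ν : ℝ) ≠ 0 := by exact_mod_cast hν
      rw [integral_mul_cos (P₁ := fun _ => -1) (P₂ := fun _ => 0) (P₃ := fun _ => 0)
        (P₄ := fun _ => 0) (fun y => by simpa using (hasDerivAt_id y).const_sub s)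
        (fun y => hasDerivAt_const _ _) (fun y => hasDerivAt_const _ _)
        (fun y => hasDerivAt_const _ _) (fun y => hasDerivAt_const _ _) (by positivity)]
      rw [show 2 * π * ν * s = 2 * (π * ν * s) by ring, cos_two_mul, cos_sq']
      field_simp
      ring
  · rw [tent_apply, norm_coe_of_abs_le (hy.trans hs), max_eq_right (by linarith)]

theorem tent_feasible {s : ℝ} (hs0 : 0 ≤ s) (hs : s ≤ 1 / 2) : Feasible s (tent s) :=
  ⟨fun ν => by rw [coeffL_tent hs0 hs]; exact tentCoeff_nonneg s ν, fun _ hx => tent_eq_zero hx.le⟩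

theorem hasSum_tentCoeff {s : ℝ} (hs0 : 0 ≤ s) (hs : s ≤ 1 / 2) : HasSum (tentCoeff s) s := by
  simpa [coeffL_tent hs0 hs, tent_zero hs0] using (tent_feasible hs0 hs).hasSum

/-- The tent of half-width `δ` has mean `δ²` and value `δ` at the origin. -/
theorem le_turan {δ : ℝ} (h0 : 0 < δ) (h : δ < 1 / 2) : δ ≤ turan δ := by
  have := (tent_feasible h0.le h.le).le_turan h
  rw [coeffL_tent h0.le h.le, tent_zero h0.le, tentCoeff_zero, Complex.ofReal_re,
    Complex.ofReal_re, sq] at this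
  exact le_of_mul_le_mul_right this h0

/-- By continuity `f` also vanishes at the end points of the arc, which are limits of points just
outside it because `δ < 1/2`. -/
theorem Feasible.eq_zero_of_le {δ : ℝ} (h0 : 0 < δ) (h : δ < 1 / 2) {f : C(UnitAddCircle, ℂ)}
    (hf : Feasible δ f) {x : UnitAddCircle} (hx : δ ≤ ‖x‖) : f x = 0 := by
  rcases hx.lt_or_eq with hx | hx
  · exact hf.eq_zero x hx
  obtain ⟨y, rfl, hy⟩ := exists_coe_abs_eq_norm x
  rw [← hx] at hy
  have hc : Continuous fun t : ℝ => f ((t * y : ℝ) : UnitAddCircle) := by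
    have : Continuous fun y : ℝ => (y : UnitAddCircle) := AddCircle.continuous_mk' 1
    fun_prop
  have ht : Tendsto (fun t : ℝ => f ((t * y : ℝ) : UnitAddCircle)) (𝓝[>] 1) (𝓝 (f y)) := by
    simpa using (hc.tendsto 1).mono_left nhdsWithin_le_nhds
  refine tendsto_nhds_unique ht (tendsto_const_nhds.congr' ?_)
  have hI : Ioo (1 : ℝ) (1 / (2 * δ)) ∈ 𝓝[>] (1 : ℝ) :=
    Ioo_mem_nhdsGT (by rw [lt_div_iff₀ (by positivity)]; linarith)
  filter_upwards [hI] with t ht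
  have h1 : |t * y| = t * δ := by rw [abs_mul, hy, abs_of_pos (by linarith [ht.1])]
  have h2 : t * δ ≤ 1 / 2 := by
    have := ht.2.le
    rw [le_div_iff₀ (by positivity)] at this
    linarith
  refine (hf.eq_zero _ ?_).symm
  rw [norm_coe_of_abs_le (by rw [h1]; exact h2), h1]
  nlinarith [ht.1]

/-! ### Averaging over finite subgroups: `a(δ) ≤ 1/q` for `δ ≤ 1/q`. -/

/-- A character summed over a finite subgroup gives the order of the subgroup or zero. -/
theorem sum_fourier_div_nonneg {q : ℕ} (hq : 0 < q) (ν : ℤ) :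
    0 ≤ ∑ k ∈ Finset.range q, fourier ν (((k : ℝ) / q : ℝ) : UnitAddCircle) := by
  let z : ℂ := fourier ν (((1 : ℝ) / q : ℝ) : UnitAddCircle)
  have hz : ∀ k : ℕ, fourier ν (((k : ℝ) / q : ℝ) : UnitAddCircle) = z ^ k := by
    intro k
    simp only [z, fourier_coe_apply, ← Complex.exp_nat_mul]
    congr 1; push_cast; ring
  have hzq : z ^ q = 1 := by
    rw [← hz, div_self (by positivity)]
    have : ((1 : ℝ) : UnitAddCircle) = 0 := AddCircle.coe_period 1
    rw [this, fourier_eval_zero]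
  simp only [hz]
  by_cases h1 : z = 1
  · simp [h1]
  · rw [geom_sum_eq h1, hzq]; simp

/-- Poisson summation over the subgroup of order `q`. -/
theorem mul_coeffL_zero_le {q : ℕ} (hq : 0 < q) {f : C(UnitAddCircle, ℂ)}
    (hf : ∀ ν, 0 ≤ coeffL ν f)
    (hz : ∀ k : ℕ, 0 < k → k < q → f (((k : ℝ) / q : ℝ) : UnitAddCircle) = 0) :
    q * (coeffL 0 f).re ≤ (f 0).re := by
  -- The sum over translates keeps the coefficients nonnegative and multiplies the zeroth one by
  -- `q`, while its value at `0` is still `f 0`.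
  let F : C(UnitAddCircle, ℂ) :=
    ∑ k ∈ Finset.range q, shift (((k : ℝ) / q : ℝ) : UnitAddCircle) f
  have hF : ∀ ν, coeffL ν F =
      (∑ k ∈ Finset.range q, fourier ν (((k : ℝ) / q : ℝ) : UnitAddCircle)) * coeffL ν f := by
    intro ν; simp only [F, map_sum, coeffL_shift, Finset.sum_mul]
  have hF1 : Feasible (1 / 2) F := by
    refine ⟨fun ν => ?_, fun x hx => absurd (norm_le_half x) (not_le.2 hx)⟩
    rw [hF]
    exact (Complex.le_def.1 (mul_nonneg (sum_fourier_div_nonneg hq ν) (hf ν))).1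
  have hF0 : F 0 = f 0 := by
    simp only [F, ContinuousMap.sum_apply, shift_apply, zero_add]
    rw [Finset.sum_eq_single_of_mem 0 (by simpa using hq)]
    · simp
    · intro k hk hk0
      exact hz k (Nat.pos_of_ne_zero hk0) (Finset.mem_range.1 hk)
  have := hF1.coeff_le 0
  rw [hF, hF0] at this
  simpa using this

theorem turan_le_of_nat {δ : ℝ} (h0 : 0 < δ) (h : δ < 1 / 2) {q : ℕ} (hq0 : 0 < q)
    (hq : δ ≤ 1 / q) : turan δ ≤ 1 / q := by
  refine turan_le h (by positivity) fun f hf hF hf0 => ?_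
  have := mul_coeffL_zero_le hq0 hf fun k hk hkq => hF.eq_zero_of_le h0 h (hq.trans ?_)
  · rw [hf0] at this
    rw [le_div_iff₀ (by positivity)]
    simpa [mul_comm] using this
  · have := AddCircle.norm_div_natCast (p := (1 : ℝ)) (m := k) (n := q)
    rw [mul_one, one_mul, Nat.mod_eq_of_lt hkq] at this
    rw [this]
    gcongr
    have : 1 ≤ min k (q - k) := by omega
    exact_mod_cast this

/-! ### Comparison with the Turán problem on the line: `a(δ) ≤ δ + 48δ³`. -/

theorem norm_apply_le {f : C(UnitAddCircle, ℂ)} (hf : ∀ ν, 0 ≤ coeffL ν f) (x : UnitAddCircle) :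
    ‖f x‖ ≤ (f 0).re := by
  have h1 := hasSum_coeffL_apply (summable_coeffL hf) x
  have h2 := Complex.hasSum_re (hasSum_coeffL_apply (summable_coeffL hf) 0)
  have hn : ∀ ν, ‖coeffL ν f * fourier ν x‖ = (coeffL ν f * fourier ν (0 : UnitAddCircle)).re := by
    intro ν
    rw [norm_mul, fourier_apply, Circle.norm_coe, fourier_eval_zero, mul_one, mul_one]
    exact (Complex.re_eq_norm.2 (hf ν)).symm
  rw [← h1.tsum_eq, ← h2.tsum_eq]
  refine (norm_tsum_le_tsum_norm ?_).trans_eq (tsum_congr hn)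
  simpa only [hn] using h2.summable

theorem continuous_coe_unitAddCircle : Continuous fun y : ℝ => (y : UnitAddCircle) :=
  AddCircle.continuous_mk' 1

theorem integral_half_eq {δ : ℝ} (hδ0 : 0 ≤ δ) (hδ : δ ≤ 1 / 2) {F : ℝ → ℂ} (hF : Continuous F)
    (h0 : ∀ y, δ < |y| → |y| ≤ 1 / 2 → F y = 0) :
    ∫ y in (-(1 / 2) : ℝ)..(1 / 2), F y = ∫ y in (-δ)..δ, F y := by
  have hi : ∀ a b, IntervalIntegrable F volume a b := fun a b => hF.intervalIntegrable a b
  have h1 : ∫ y in (-(1 / 2) : ℝ)..(-δ), F y = 0 := by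
    rw [intervalIntegral.integral_of_le (by linarith), integral_Ioc_eq_integral_Ioo]
    refine setIntegral_eq_zero_of_forall_eq_zero fun y hy => h0 y ?_ ?_
    · rw [lt_abs]; right; linarith [hy.2]
    · rw [abs_le]; constructor <;> linarith [hy.1, hy.2]
  have h2 : ∫ y in δ..(1 / 2), F y = 0 := by
    rw [intervalIntegral.integral_of_le (by linarith), integral_Ioc_eq_integral_Ioo]
    refine setIntegral_eq_zero_of_forall_eq_zero fun y hy => h0 y ?_ ?_
    · rw [lt_abs]; left; linarith [hy.1]
    · rw [abs_le]; constructor <;> linarith [hy.1, hy.2]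
  rw [← intervalIntegral.integral_add_adjacent_intervals (hi _ (-δ)) (hi _ _), h1,
    ← intervalIntegral.integral_add_adjacent_intervals (hi _ δ) (hi _ _), h2]
  simp

/-- The Cusa–Huygens inequality. -/
theorem three_mul_sin_le {t : ℝ} (ht : 0 ≤ t) : 3 * Real.sin t ≤ t * (2 + Real.cos t) := by
  rcases le_total Real.pi t with h | h
  · nlinarith [Real.sin_le_one t, Real.neg_one_le_cos t, Real.pi_gt_three]
  have hmono : MonotoneOn (fun t => t * (2 + Real.cos t) - 3 * Real.sin t) (Icc 0 Real.pi) := by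
    have hd : ∀ t : ℝ, HasDerivAt (fun t => t * (2 + Real.cos t) - 3 * Real.sin t)
        (2 - 2 * Real.cos t - t * Real.sin t) t := by
      intro t
      have := ((hasDerivAt_id t).mul ((Real.hasDerivAt_cos t).const_add 2)).sub
        ((Real.hasDerivAt_sin t).const_mul 3)
      exact this.congr_deriv (by simp; ring)
    refine monotoneOn_of_deriv_nonneg (convex_Icc _ _)
      (fun t _ => (hd t).continuousAt.continuousWithinAt)
      (fun t _ => (hd t).differentiableAt.differentiableWithinAt) fun t ht => ?_
    rw [interior_Icc] at ht
    rw [(hd t).deriv]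
    have hh : t / 2 < Real.pi / 2 := by linarith [ht.2]
    have hs := Real.sin_pos_of_pos_of_lt_pi (half_pos ht.1) (by linarith [ht.2, ht.1])
    have hc := Real.cos_pos_of_mem_Ioo ⟨by linarith [ht.1, Real.pi_pos], hh⟩
    have htan := Real.lt_tan (half_pos ht.1) hh
    rw [Real.tan_eq_sin_div_cos, lt_div_iff₀ hc] at htan
    have e1 : Real.cos t = 1 - 2 * Real.sin (t / 2) ^ 2 := by
      rw [show t = 2 * (t / 2) by ring, Real.cos_two_mul, Real.cos_sq']; ring_nf
    have e2 : Real.sin t = 2 * Real.sin (t / 2) * Real.cos (t / 2) := by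
      rw [← Real.sin_two_mul]; ring_nf
    rw [e1, e2]
    -- The derivative equals `4 sin(t/2) (sin(t/2) - (t/2) cos(t/2))`, which is positive because
    -- `t/2 < tan(t/2)`.
    nlinarith [mul_pos hs (sub_pos.2 htan)]
  have := hmono ⟨le_rfl, Real.pi_pos.le⟩ ⟨ht, h⟩ ht
  simp only [Real.cos_zero, Real.sin_zero] at this
  linarith

/-- Wendland's `C²` positive definite function, supported in `[-1/2, 1/2]`, as a function of
`|x|`. -/
def wendland (y : ℝ) : ℝ := (1 - 2 * y) ^ 3 * (1 + 6 * y)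

theorem continuous_wendland : Continuous wendland := by unfold wendland; fun_prop

theorem wendland_nonneg {y : ℝ} (h0 : 0 ≤ y) (h : y ≤ 1 / 2) : 0 ≤ wendland y :=
  mul_nonneg (pow_nonneg (by linarith) 3) (by linarith)

theorem wendland_le_one (y : ℝ) : wendland y ≤ 1 := by
  have : 1 - wendland y = 24 * y ^ 2 * ((1 - 4 / 3 * y) ^ 2 + 2 / 9 * y ^ 2) := by
    unfold wendland; ring
  have h2 : 0 ≤ 24 * y ^ 2 * ((1 - 4 / 3 * y) ^ 2 + 2 / 9 * y ^ 2) := by positivity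
  linarith

theorem one_sub_wendland_le {y : ℝ} (h0 : 0 ≤ y) (h : y ≤ 1 / 2) :
    1 - wendland y ≤ 24 * y ^ 2 := by
  have : 24 * y ^ 2 - (1 - wendland y) = 16 * y ^ 3 * (4 - 3 * y) := by
    unfold wendland; ring
  have h2 : 0 ≤ 16 * y ^ 3 * (4 - 3 * y) := mul_nonneg (by positivity) (by linarith)
  linarith

theorem integral_wendland_mul_cos_nonneg (w : ℝ) :
    0 ≤ ∫ y in (0 : ℝ)..(1 / 2), wendland y * Real.cos (w * y) := by
  rcases eq_or_ne w 0 with rfl | hw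
  · refine intervalIntegral.integral_nonneg (by norm_num) fun y hy => ?_
    simpa using wendland_nonneg hy.1 hy.2
  have e : wendland = fun y => 1 - 24 * y ^ 2 + 64 * y ^ 3 - 48 * y ^ 4 := by
    ext y; unfold wendland; ring
  rw [integral_mul_cos (P₁ := fun y => -48 * y + 192 * y ^ 2 - 192 * y ^ 3)
    (P₂ := fun y => -48 + 384 * y - 576 * y ^ 2) (P₃ := fun y => 384 - 1152 * y)
    (P₄ := fun _ => -1152) ?_ ?_ ?_ ?_ (fun y => hasDerivAt_const _ _) hw]
  -- The boundary terms collapse to `768 / w⁶` times this expression, so positivity of the transform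
  -- is the Cusa–Huygens inequality at `w/2`.
  · have key : 0 ≤ (w / 2) * ((w / 2) * (2 + Real.cos (w / 2)) - 3 * Real.sin (w / 2)) := by
      rcases le_total 0 w with h | h
      · exact mul_nonneg (by linarith) (sub_nonneg.2 (three_mul_sin_le (by linarith)))
      · have := three_mul_sin_le (t := -(w / 2)) (by linarith)
        rw [Real.sin_neg, Real.cos_neg] at this
        exact mul_nonneg_of_nonpos_of_nonpos (by linarith) (by linarith)
    have h2 := mul_nonneg key (show 0 ≤ 768 / w ^ 6 by positivity)
    refine h2.trans_eq ?_
    rw [e, show w * (1 / 2) = w / 2 by ring]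
    field_simp
    ring
  · intro y
    rw [e]
    have := ((((hasDerivAt_pow 2 y).const_mul 24).const_sub 1).add
      ((hasDerivAt_pow 3 y).const_mul 64)).sub ((hasDerivAt_pow 4 y).const_mul 48)
    exact this.congr_deriv (by norm_num; ring)
  · intro y
    have := (((hasDerivAt_id y).const_mul (-48)).add ((hasDerivAt_pow 2 y).const_mul 192)).sub
      ((hasDerivAt_pow 3 y).const_mul 192)
    exact this.congr_deriv (by norm_num; ring)
  · intro y
    have := (((hasDerivAt_id y).const_mul 384).const_add (-48)).sub
      ((hasDerivAt_pow 2 y).const_mul 576)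
    exact this.congr_deriv (by norm_num; ring)
  · intro y
    have := ((hasDerivAt_id y).const_mul 1152).const_sub 384
    exact this.congr_deriv (by norm_num)

theorem integral_wendland_exp_nonneg (ξ : ℝ) :
    0 ≤ ∫ y in (-(1 / 2) : ℝ)..(1 / 2),
      Complex.exp (-(2 * Real.pi * Complex.I * ξ * y)) * (wendland |y| : ℂ) := by
  let F : ℝ → ℂ := fun y => Complex.exp (-(2 * Real.pi * Complex.I * ξ * y)) * (wendland |y| : ℂ)
  have hF : Continuous F := by
    have := continuous_wendland
    fun_prop
  have hn : Continuous fun y => F (-y) := hF.comp continuous_neg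
  have hFi : ∀ a b, IntervalIntegrable F volume a b := fun a b => hF.intervalIntegrable a b
  have h1 : (∫ y in (-(1 / 2) : ℝ)..(1 / 2), F y) = ∫ y in (0 : ℝ)..(1 / 2), (F y + F (-y)) := by
    rw [intervalIntegral.integral_add (hFi _ _) (hn.intervalIntegrable _ _),
      intervalIntegral.integral_comp_neg (f := F), neg_zero, add_comm (∫ y in _.._, F y),
      intervalIntegral.integral_add_adjacent_intervals (hFi _ _) (hFi _ _)]
  have h3 : (∫ y in (0 : ℝ)..(1 / 2), (F y + F (-y))) =
      ∫ y in (0 : ℝ)..(1 / 2),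
        ((2 * (wendland y * Real.cos (2 * Real.pi * ξ * y)) : ℝ) : ℂ) := by
    refine intervalIntegral.integral_congr fun y hy => ?_
    rw [uIcc_of_le (by norm_num)] at hy
    have hy1 : |y| = y := abs_of_nonneg hy.1
    simp only [F, hy1, abs_neg]
    push_cast
    rw [← add_mul, Complex.cos]
    ring_nf
  change 0 ≤ ∫ y in (-(1 / 2) : ℝ)..(1 / 2), F y
  rw [h1, h3, intervalIntegral.integral_ofReal, intervalIntegral.integral_const_mul]
  exact_mod_cast mul_nonneg zero_le_two (integral_wendland_mul_cos_nonneg _)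

/-- The product of a positive definite function with Wendland's function is positive definite
on the line. -/
theorem integral_wendland_mul_nonneg {f : C(UnitAddCircle, ℂ)} (hf : ∀ ν, 0 ≤ coeffL ν f) (ξ : ℝ) :
    0 ≤ ∫ y in (-(1 / 2) : ℝ)..(1 / 2),
      Complex.exp (-(2 * Real.pi * Complex.I * ξ * y)) * (wendland |y| : ℂ) * f y := by
  have hs := summable_coeffL hf
  -- Expanding `f` in its Fourier series writes the transform as a sum of translates of Wendland's
  -- transform with the nonnegative weights `coeffL ν f`.
  have hsum := intervalIntegral.hasSum_integral_of_dominated_convergence (μ := volume)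
    (a := -(1 / 2)) (b := 1 / 2)
    (F := fun (ν : ℤ) (y : ℝ) => Complex.exp (-(2 * Real.pi * Complex.I * ξ * y)) *
      (wendland |y| : ℂ) * (coeffL ν f * fourier ν (y : UnitAddCircle)))
    (f := fun y : ℝ => Complex.exp (-(2 * Real.pi * Complex.I * ξ * y)) *
      (wendland |y| : ℂ) * f y)
    (fun ν y => ‖coeffL ν f‖) ?_ ?_ ?_ ?_ ?_
  · refine hsum.nonneg fun ν => ?_
    have := mul_nonneg (hf ν) (integral_wendland_exp_nonneg (ξ - ν))
    rw [← intervalIntegral.integral_const_mul] at this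
    refine this.trans_eq (intervalIntegral.integral_congr fun y _ => ?_)
    rw [fourier_coe_apply]
    have : Complex.exp (-(2 * Real.pi * Complex.I * ((ξ - ν : ℝ) : ℂ) * y)) =
        Complex.exp (-(2 * Real.pi * Complex.I * ξ * y)) *
          Complex.exp (2 * Real.pi * Complex.I * ν * y / (1 : ℝ)) := by
      rw [← Complex.exp_add]; congr 1; push_cast; ring
    rw [this]; ring
  · intro ν
    have := continuous_wendland
    have := continuous_coe_unitAddCircle
    exact Continuous.aestronglyMeasurable (by fun_prop)
  · intro ν
    refine ae_of_all _ fun y hy => ?_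
    rw [uIoc_of_le (by norm_num)] at hy
    have h1 : |y| ≤ 1 / 2 := abs_le.2 ⟨hy.1.le, hy.2⟩
    have h2 : ‖(wendland |y| : ℂ)‖ ≤ 1 := by
      rw [Complex.norm_real, Real.norm_eq_abs, abs_of_nonneg (wendland_nonneg (abs_nonneg y) h1)]
      exact wendland_le_one _
    have h3 : ‖Complex.exp (-(2 * Real.pi * Complex.I * ξ * y))‖ = 1 := by
      rw [Complex.norm_exp]; simp
    rw [norm_mul, norm_mul, norm_mul, h3, fourier_apply, Circle.norm_coe, one_mul, mul_one]
    exact mul_le_of_le_one_left (norm_nonneg _) h2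
  · exact ae_of_all _ fun y _ => hs.norm
  · simp
  · exact ae_of_all _ fun y _ => (hasSum_coeffL_apply hs _).mul_left _

/-- The product of `f` and Wendland's function, cut to one period, is positive definite on the line,
so it may be dilated freely. Dilate its support `[-δ, δ]` to the whole period: the resulting circle
function `v` has nonnegative coefficients and vanishes at `1/2`, so averaging over the subgroup of
order `2` gives `2 v̂₀ ≤ v(0)`. -/
theorem integral_wendland_mul_le {δ : ℝ} (h0 : 0 < δ) (h : δ < 1 / 2) {f : C(UnitAddCircle, ℂ)}
    (hf : ∀ ν, 0 ≤ coeffL ν f) (hF : Feasible δ f) :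
    (∫ y in (-(1 / 2) : ℝ)..(1 / 2), (wendland |y| : ℂ) * f y).re ≤ δ * (f 0).re := by
  let u : ℝ → ℂ := fun y => (wendland |y| : ℂ) * f y
  have hu : Continuous u := by
    have := continuous_wendland
    have := continuous_coe_unitAddCircle
    fun_prop
  have hu0 : ∀ y, δ ≤ |y| → |y| ≤ 1 / 2 → u y = 0 := fun y h1 h2 => by
    simp only [u]
    rw [hF.eq_zero_of_le h0 h (by rwa [norm_coe_of_abs_le h2]), mul_zero]
  let w : ℝ → ℂ := fun y => u (2 * δ * y)
  have hw : Continuous w := hu.comp (by fun_prop)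
  have hwa : w (-(1 / 2)) = 0 := hu0 _
    (by rw [show 2 * δ * -(1 / 2) = -δ by ring, abs_neg, abs_of_pos h0])
    (by rw [show 2 * δ * -(1 / 2) = -δ by ring, abs_neg, abs_of_pos h0]; exact h.le)
  have hwb : w (-(1 / 2) + 1) = 0 := hu0 _
    (by rw [show 2 * δ * (-(1 / 2) + 1) = δ by ring, abs_of_pos h0])
    (by rw [show 2 * δ * (-(1 / 2) + 1) = δ by ring, abs_of_pos h0]; exact h.le)
  let v : C(UnitAddCircle, ℂ) := ⟨AddCircle.liftIco 1 (-(1 / 2)) w,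
    AddCircle.liftIco_continuous (hwa.trans hwb.symm) hw.continuousOn⟩
  have hv : ∀ j : ℤ, coeffL j v = ((1 / (2 * δ) : ℝ) : ℂ) * ∫ y in (-(1 / 2) : ℝ)..(1 / 2),
      Complex.exp (-(2 * Real.pi * Complex.I * ((j / (2 * δ) : ℝ) : ℂ) * y)) *
        (wendland |y| : ℂ) * f y := by
    intro j
    let E : ℝ → ℂ := fun y =>
      Complex.exp (-(2 * Real.pi * Complex.I * ((j / (2 * δ) : ℝ) : ℂ) * y)) * u y
    have hE : Continuous E := by fun_prop
    have h1 : coeffL j v = ∫ y in (-(1 / 2) : ℝ)..(1 / 2), E (2 * δ * y) := by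
      rw [coeffL_apply]
      change fourierCoeff (AddCircle.liftIco 1 (-(1 / 2)) w) j = _
      rw [fourierCoeff_liftIco_eq, fourierCoeffOn_eq_integral]
      simp only [add_sub_cancel_left, div_one, one_smul, fourier_coe_apply, smul_eq_mul]
      rw [show -(1 / 2) + 1 = (1 / 2 : ℝ) by norm_num]
      refine intervalIntegral.integral_congr fun y _ => ?_
      simp only [E, w]
      congr 2
      push_cast
      have : (δ : ℂ) ≠ 0 := by exact_mod_cast h0.ne'
      field_simp
    rw [h1, intervalIntegral.integral_comp_mul_left (f := E) (by positivity)]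
    rw [show 2 * δ * -(1 / 2) = -δ by ring, show 2 * δ * (1 / 2) = δ by ring,
      ← integral_half_eq h0.le h.le hE fun y h1 h2 => by simp [E, hu0 y h1.le h2]]
    rw [Complex.real_smul, one_div]
    simp only [E, u, mul_assoc, one_div]
  have hvpos : ∀ j, 0 ≤ coeffL j v := fun j => by
    rw [hv]
    exact mul_nonneg (by exact_mod_cast (by positivity)) (integral_wendland_mul_nonneg hf _)
  have hmem : (0 : ℝ) ∈ Ico (-(1 / 2) : ℝ) (-(1 / 2) + 1) := ⟨by norm_num, by norm_num⟩
  have hv0 : v 0 = f 0 := by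
    have := AddCircle.liftIco_coe_apply (p := (1 : ℝ)) (f := w) hmem
    change AddCircle.liftIco 1 (-(1 / 2)) w ((0 : ℝ) : UnitAddCircle) = _
    rw [this]
    simp [w, u, wendland]
  have hvh : v ((1 / 2 : ℝ) : UnitAddCircle) = 0 := by
    have e : ((1 / 2 : ℝ) : UnitAddCircle) = ((-(1 / 2) : ℝ) : UnitAddCircle) := by
      rw [← AddCircle.coe_add_period (1 : ℝ) (-(1 / 2))]; norm_num
    rw [e]
    exact (AddCircle.liftIco_coe_apply (p := (1 : ℝ)) (f := w)
      ⟨le_rfl, by norm_num⟩).trans hwa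
  have := mul_coeffL_zero_le (q := 2) (by norm_num) hvpos fun k h1 h2 => by
    obtain rfl : k = 1 := by omega
    simpa using hvh
  rw [hv, hv0, Complex.re_ofReal_mul] at this
  simp only [Int.cast_zero, zero_div, Complex.ofReal_zero, mul_zero, zero_mul, neg_zero,
    Complex.exp_zero, one_mul] at this
  have h2 : 2 * (1 / (2 * δ)) = 1 / δ := by field_simp
  push_cast at this
  rw [← mul_assoc, h2, one_div, inv_mul_le_iff₀ h0] at this
  exact this

/-- Split `f` by Wendland's function `φ`. The part `φ f` contributes at most `δ`. On the support, of
length `2δ`, one has `|(1 - φ) f| ≤ 24δ²`, which contributes at most `48δ³`. -/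
theorem turan_le_add {δ : ℝ} (h0 : 0 < δ) (h : δ < 1 / 2) : turan δ ≤ δ + 48 * δ ^ 3 := by
  refine turan_le h (by positivity) fun f hf hF hf0 => ?_
  have h1 := integral_wendland_mul_le h0 h hf hF
  have c1 : Continuous fun y : ℝ => f (y : UnitAddCircle) :=
    f.continuous.comp continuous_coe_unitAddCircle
  have c2 : Continuous fun y : ℝ => (wendland |y| : ℂ) := by
    have := continuous_wendland
    fun_prop
  have c3 : Continuous fun y : ℝ => (wendland |y| : ℂ) * f y := c2.mul c1
  have c4 : Continuous fun y : ℝ => (1 - (wendland |y| : ℂ)) * f y :=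
    (continuous_const.sub c2).mul c1
  have h2 : coeffL 0 f = (∫ y in (-(1 / 2) : ℝ)..(1 / 2), (wendland |y| : ℂ) * f y) +
      ∫ y in (-(1 / 2) : ℝ)..(1 / 2), (1 - (wendland |y| : ℂ)) * f y := by
    rw [← intervalIntegral.integral_add (c3.intervalIntegrable _ _)
      (c4.intervalIntegrable _ _), coeffL_apply,
      fourierCoeff_eq_intervalIntegral f 0 (-(1 / 2))]
    simp only [neg_zero, fourier_zero, one_smul, div_one]
    rw [show -(1 / 2) + 1 = (1 / 2 : ℝ) by norm_num]
    refine intervalIntegral.integral_congr fun y _ => ?_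
    ring
  have h3 : ‖∫ y in (-(1 / 2) : ℝ)..(1 / 2), (1 - (wendland |y| : ℂ)) * f y‖
      ≤ 24 * δ ^ 2 * |δ - -δ| := by
    rw [integral_half_eq h0.le h.le c4 fun y h1 h2 => by
      rw [hF.eq_zero _ (by rwa [norm_coe_of_abs_le h2]), mul_zero]]
    refine intervalIntegral.norm_integral_le_of_norm_le_const fun y hy => ?_
    rw [uIoc_of_le (by linarith)] at hy
    have hy1 : |y| ≤ δ := abs_le.2 ⟨hy.1.le, hy.2⟩
    have hy2 : |y| ≤ 1 / 2 := hy1.trans h.le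
    have e : (1 - (wendland |y| : ℂ)) = ((1 - wendland |y| : ℝ) : ℂ) := by push_cast; rfl
    have e1 : ‖f y‖ ≤ 1 := by simpa [hf0] using norm_apply_le hf (y : UnitAddCircle)
    rw [norm_mul, e, Complex.norm_real, Real.norm_eq_abs,
      abs_of_nonneg (sub_nonneg.2 (wendland_le_one _))]
    calc _ ≤ (1 - wendland |y|) * 1 := by
          gcongr
          exact sub_nonneg.2 (wendland_le_one _)
      _ ≤ 24 * |y| ^ 2 := by rw [mul_one]; exact one_sub_wendland_le (abs_nonneg y) hy2
      _ ≤ 24 * δ ^ 2 := by gcongr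
  rw [show δ - -δ = 2 * δ by ring, abs_of_pos (by positivity)] at h3
  have h4 := (Complex.re_le_norm _).trans h3
  rw [hf0, Complex.one_re, mul_one] at h1
  rw [h2, Complex.add_re]
  nlinarith

/-! ### Strict inequality `δ < a(δ)` when `1/δ` is not an integer. -/

theorem abs_sin_nat_mul_le (n : ℕ) (x : ℝ) : |Real.sin (n * x)| ≤ n * |Real.sin x| := by
  induction n with
  | zero => simp
  | succ n ih =>
    push_cast
    rw [add_mul, one_mul, Real.sin_add, add_mul, one_mul]
    refine (abs_add_le _ _).trans (add_le_add ?_ ?_)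
    · rw [abs_mul]
      exact (mul_le_of_le_one_right (abs_nonneg _) (Real.abs_cos_le_one _)).trans ih
    · rw [abs_mul]
      exact mul_le_of_le_one_left (abs_nonneg _) (Real.abs_cos_le_one _)

theorem sin_sq_int_mul_le (n : ℤ) (x : ℝ) : Real.sin (n * x) ^ 2 ≤ (n : ℝ) ^ 2 * Real.sin x ^ 2 := by
  have h : |Real.sin (n * x)| ≤ |(n : ℝ) * Real.sin x| := by
    have := abs_sin_nat_mul_le n.natAbs x
    have e : ((n.natAbs : ℕ) : ℝ) = |(n : ℝ)| := by rw [Nat.cast_natAbs]; simp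
    rw [e] at this
    rw [abs_mul]
    rcases abs_choice (n : ℝ) with h | h
    · rw [h] at this ⊢; exact this
    · rw [h, neg_mul, Real.sin_neg, abs_neg] at this; rw [h]; exact this
  rw [← mul_pow]
  exact sq_le_sq.2 h

/-- Let `δ = p/r` in lowest terms, so `p ≥ 2`. The function `tent (2/r) - 2 • tent (1/r)` is
supported in `[-δ, δ]`, vanishes at `0` and has positive mean. Its coefficients can be negative only
through `sin²(πν/r)`, which is controlled by `sin²(πνδ)` from the tent of half-width `δ`. -/
theorem lt_turan_of_rat {x : ℚ} (h0 : (0 : ℝ) < x) (h : (x : ℝ) < 1 / 2)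
    (hx : ¬ ∃ q : ℕ, 1 / (x : ℝ) = q) : (x : ℝ) < turan x := by
  obtain ⟨δ, hδ⟩ : ∃ δ : ℝ, δ = x := ⟨_, rfl⟩
  rw [← hδ] at h0 h hx ⊢
  have hr0 : (0 : ℝ) < x.den := by exact_mod_cast x.den_pos
  have hxr : δ = x.num / x.den := by rw [hδ]; exact Rat.cast_def x
  have hp0 : 0 < x.num := by
    rw [Rat.num_pos]; rw [hδ] at h0; exact_mod_cast h0
  have hp2 : 2 ≤ x.num := by
    by_contra! hlt
    have h1 : x.num = 1 := by omega
    exact hx ⟨x.den, by rw [hxr, h1]; simp⟩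
  have hp2' : (2 : ℝ) ≤ x.num := by exact_mod_cast hp2
  have h2r : 2 / (x.den : ℝ) ≤ δ := by rw [hxr]; gcongr
  have h1r : 1 / (x.den : ℝ) ≤ δ := le_trans (by gcongr; norm_num) h2r
  -- By Bézout, `πν/r` differs from `a · πνδ` by a multiple of `π`, and `|sin(a x)| ≤ |a| |sin x|`.
  obtain ⟨a, b, hab⟩ : IsCoprime x.num (x.den : ℤ) := by
    rw [Int.isCoprime_iff_gcd_eq_one]; exact x.reduced
  have hab' : (a : ℝ) * x.num + b * x.den = 1 := by exact_mod_cast hab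
  have hsin : ∀ ν : ℤ, Real.sin (Real.pi * ν * (1 / x.den)) ^ 2 ≤
      ((a : ℝ) ^ 2 + 1) * Real.sin (Real.pi * ν * δ) ^ 2 := by
    intro ν
    have e : Real.pi * ν * (1 / x.den) = a * (Real.pi * ν * δ) + (ν * b : ℤ) * Real.pi := by
      rw [hxr]; push_cast
      field_simp
      linear_combination (-(ν : ℝ)) * hab'
    have h1 : Real.sin (Real.pi * ν * (1 / x.den)) ^ 2 = Real.sin (a * (Real.pi * ν * δ)) ^ 2 := by
      rw [e, Real.sin_add_int_mul_pi, mul_pow]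
      rcases Int.even_or_odd (ν * b) with hb | hb
      · rw [hb.neg_one_zpow]; ring
      · rw [hb.neg_one_zpow]; ring
    rw [h1]
    refine (sin_sq_int_mul_le _ _).trans ?_
    nlinarith [sq_nonneg (Real.sin (Real.pi * ν * δ))]
  -- Chosen so that `2ε(a² + 1) = δ⁻¹`, the weight of the main tent.
  let ε : ℝ := 1 / (2 * δ * ((a : ℝ) ^ 2 + 1))
  have hε : 0 < ε := by positivity
  let f : C(UnitAddCircle, ℂ) := ((δ⁻¹ : ℝ) : ℂ) • tent δ +
    (ε : ℂ) • (tent (2 / x.den) - (2 : ℂ) • tent (1 / x.den))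
  have hf : ∀ ν, coeffL ν f = ((δ⁻¹ * tentCoeff δ ν +
      ε * (tentCoeff (2 / x.den) ν - 2 * tentCoeff (1 / x.den) ν) : ℝ) : ℂ) := by
    intro ν
    simp only [f, map_add, map_smul, map_sub, coeffL_tent h0.le h.le,
      coeffL_tent (s := 2 / (x.den : ℝ)) (by positivity) (h2r.trans h.le),
      coeffL_tent (s := 1 / (x.den : ℝ)) (by positivity) (h1r.trans h.le)]
    push_cast
    simp
  have hfe : Feasible δ f := by
    refine ⟨fun ν => ?_, fun y hy => ?_⟩
    · rw [hf, Complex.ofReal_re]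
      by_cases hν : ν = 0
      · subst hν
        simp only [tentCoeff_zero]
        have : 0 ≤ (2 / (x.den : ℝ)) ^ 2 - 2 * (1 / (x.den : ℝ)) ^ 2 := by
          have : (2 / (x.den : ℝ)) ^ 2 - 2 * (1 / (x.den : ℝ)) ^ 2 = 2 * (1 / (x.den : ℝ)) ^ 2 := by
            ring
          rw [this]; positivity
        positivity
      · simp only [tentCoeff, if_neg hν, div_pow]
        have hν' : (0 : ℝ) < (Real.pi * ν) ^ 2 := by
          have : (ν : ℝ) ≠ 0 := by exact_mod_cast hν
          positivity
        have h3 : 0 ≤ δ⁻¹ * Real.sin (Real.pi * ν * δ) ^ 2 + ε * (Real.sin (Real.pi * ν * (2 / x.den)) ^ 2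
            - 2 * Real.sin (Real.pi * ν * (1 / x.den)) ^ 2) := by
          have h4 := mul_le_mul_of_nonneg_left (hsin ν) (show 0 ≤ 2 * ε by positivity)
          have h5 : 2 * ε * (((a : ℝ) ^ 2 + 1) * Real.sin (Real.pi * ν * δ) ^ 2) =
              δ⁻¹ * Real.sin (Real.pi * ν * δ) ^ 2 := by
            simp only [ε]; field_simp
          have h6 := mul_nonneg hε.le (sq_nonneg (Real.sin (Real.pi * ν * (2 / x.den))))
          linarith
        have := div_nonneg h3 hν'.le
        refine this.trans_eq ?_
        ring
    · simp [f, tent_eq_zero hy.le, tent_eq_zero (h2r.trans hy.le),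
        tent_eq_zero (s := 1 / (x.den : ℝ)) (h1r.trans hy.le), -one_div]
  have hf0 : f 0 = 1 := by
    simp only [f, ContinuousMap.add_apply, ContinuousMap.smul_apply, ContinuousMap.sub_apply,
      tent_zero h0.le, tent_zero (s := 2 / (x.den : ℝ)) (by positivity),
      tent_zero (s := 1 / (x.den : ℝ)) (by positivity), smul_eq_mul]
    have : (δ : ℂ) ≠ 0 := by exact_mod_cast h0.ne'
    push_cast
    field_simp
    ring
  have := hfe.le_turan h
  rw [hf, hf0, Complex.ofReal_re, Complex.one_re, mul_one] at this
  simp only [tentCoeff_zero] at this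
  refine lt_of_lt_of_le ?_ this
  have e : δ⁻¹ * δ ^ 2 + ε * ((2 / (x.den : ℝ)) ^ 2 - 2 * (1 / (x.den : ℝ)) ^ 2) =
      δ + ε * (2 * (1 / (x.den : ℝ)) ^ 2) := by field_simp; ring
  rw [e]
  have : 0 < ε * (2 * (1 / (x.den : ℝ)) ^ 2) := by positivity
  linarith

/-- A function on `[0, δ]` with a downward kink at the origin, vanishing there, and of positive
mean. -/
def kink (δ y : ℝ) : ℝ := y * (δ - y) ^ 2 * (5 * y / δ - 1)

/-- The even function on the circle determined by `kink`. -/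
def kinkMap (δ : ℝ) : C(UnitAddCircle, ℂ) :=
  ⟨fun x => (kink δ (min ‖x‖ δ) : ℂ), by unfold kink; fun_prop⟩

theorem kinkMap_eq_zero {δ : ℝ} {x : UnitAddCircle} (hx : δ ≤ ‖x‖) : kinkMap δ x = 0 := by
  simp [kinkMap, kink, hx]

theorem kinkMap_zero {δ : ℝ} (h0 : 0 < δ) : kinkMap δ 0 = 0 := by
  simp [kinkMap, kink, h0.le]

/-- The Fourier coefficients of `kinkMap`. -/
def kinkCoeff (δ : ℝ) (ν : ℤ) : ℝ :=
  2 * ∫ y in (0 : ℝ)..δ, kink δ y * Real.cos (2 * Real.pi * ν * y)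

theorem coeffL_kinkMap {δ : ℝ} (h0 : 0 < δ) (h : δ < 1 / 2) (ν : ℤ) :
    coeffL ν (kinkMap δ) = (kinkCoeff δ ν : ℂ) := by
  refine coeffL_even h0.le h.le (fun y hy => ?_) (fun x hx => kinkMap_eq_zero hx.le) ν
  simp [kinkMap, norm_coe_of_abs_le (hy.trans h.le), hy]

theorem kinkCoeff_zero {δ : ℝ} (h0 : 0 < δ) : kinkCoeff δ 0 = δ ^ 4 / 6 := by
  have key : ∀ y, HasDerivAt (fun y => -δ ^ 2 * y ^ 2 / 2 + 7 * δ * y ^ 3 / 3 - 11 * y ^ 4 / 4 +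
      1 / δ * y ^ 5) (kink δ y) y := by
    intro y
    have := (((((hasDerivAt_pow 2 y).const_mul (-δ ^ 2)).div_const 2).add
      (((hasDerivAt_pow 3 y).const_mul (7 * δ)).div_const 3)).sub
      (((hasDerivAt_pow 4 y).const_mul 11).div_const 4)).add ((hasDerivAt_pow 5 y).const_mul (1 / δ))
    refine this.congr_deriv ?_
    unfold kink
    norm_num
    field_simp
    ring
  unfold kinkCoeff
  have e : ∫ y in (0 : ℝ)..δ, kink δ y * Real.cos (2 * Real.pi * (0 : ℤ) * y) =
      ∫ y in (0 : ℝ)..δ, kink δ y := by simp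
  rw [e, intervalIntegral.integral_eq_sub_of_hasDerivAt (fun y _ => key y)
    (by apply Continuous.intervalIntegrable; unfold kink; fun_prop)]
  field_simp
  ring

/-- The downward slope `-δ²` at the origin contributes `2δ²/w²` with `w = 2πν`. This dominates for
large `|w|`, since the double zero at `δ` removes every other term of that order. -/
theorem exists_kinkCoeff_nonneg {δ : ℝ} (h0 : 0 < δ) :
    ∃ N : ℕ, ∀ ν : ℤ, (N : ℤ) < |ν| → 0 ≤ kinkCoeff δ ν := by
  -- The summands are the absolute values of the derivatives left after integration by parts: the
  -- second and third at `δ`, the constant fourth, and the third at `0`.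
  let C : ℝ := 8 * δ + 54 + 120 / δ + 66
  have hC : 0 < C := by positivity
  obtain ⟨N, hN⟩ := exists_nat_gt (C / δ ^ 2)
  refine ⟨N, fun ν hν => ?_⟩
  have hν1 : (N : ℝ) < |(ν : ℝ)| := by exact_mod_cast hν
  have hν2 : (1 : ℝ) ≤ |(ν : ℝ)| := by
    have : (1 : ℤ) ≤ |ν| := by omega
    exact_mod_cast this
  have hν0 : (ν : ℝ) ≠ 0 := fun h => by simp [h] at hν2; linarith
  set w : ℝ := 2 * Real.pi * ν with hw
  have hw0 : w ≠ 0 := mul_ne_zero (by positivity) hν0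
  have hwν : |(ν : ℝ)| ≤ |w| := by
    rw [hw, abs_mul, abs_of_pos (show 0 < 2 * Real.pi by positivity)]
    have := Real.pi_gt_three
    nlinarith [abs_nonneg (ν : ℝ)]
  have hw1 : 1 ≤ |w| := hν2.trans hwν
  have hCw : C / |w| ≤ δ ^ 2 := by
    rw [div_le_iff₀ (by positivity)]
    rw [div_lt_iff₀ (by positivity)] at hN
    nlinarith [sq_nonneg δ, hν1.trans_le hwν]
  unfold kinkCoeff
  have hk : kink δ = fun y => -δ ^ 2 * y + 7 * δ * y ^ 2 - 11 * y ^ 3 + 5 / δ * y ^ 4 := by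
    ext y; unfold kink; field_simp; ring
  rw [integral_mul_cos (P₁ := fun y => -δ ^ 2 + 14 * δ * y - 33 * y ^ 2 + 20 / δ * y ^ 3)
    (P₂ := fun y => 14 * δ - 66 * y + 60 / δ * y ^ 2) (P₃ := fun y => -66 + 120 / δ * y)
    (P₄ := fun _ => 120 / δ) ?_ ?_ ?_ ?_ (fun y => hasDerivAt_const _ _) hw0]
  · have b1 : |Real.sin (w * δ) / w| ≤ 1 / |w| := by
      rw [abs_div]; gcongr; exact Real.abs_sin_le_one _
    have b0 : 1 / |w| ^ 2 ≤ 1 / |w| := by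
      gcongr; nlinarith
    have b00 : 1 / |w| ^ 3 ≤ 1 / |w| := by
      gcongr; nlinarith [mul_nonneg (sub_nonneg.2 hw1) (sub_nonneg.2 hw1)]
    have b2 : |Real.cos (w * δ) / w ^ 2| ≤ 1 / |w| := by
      rw [abs_div, abs_pow]; refine le_trans ?_ b0; gcongr; exact Real.abs_cos_le_one _
    have b3 : |Real.sin (w * δ) / w ^ 3| ≤ 1 / |w| := by
      rw [abs_div, abs_pow]; refine le_trans ?_ b00; gcongr; exact Real.abs_sin_le_one _
    have b4 : 1 / w ^ 2 ≤ 1 / |w| := by rw [← sq_abs]; exact b0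
    have h3 := mul_le_mul_of_nonneg_left (le_of_abs_le b1) (show 0 ≤ 8 * δ by positivity)
    have h4 := mul_le_mul_of_nonneg_left (neg_le_of_abs_le b3) (show 0 ≤ 120 / δ by positivity)
    have main : 0 ≤ δ ^ 2 - 8 * δ * (Real.sin (w * δ) / w) - 54 * (Real.cos (w * δ) / w ^ 2)
        + 120 / δ * (Real.sin (w * δ) / w ^ 3) - 66 * (1 / w ^ 2) := by
      have e : C / |w| = 8 * δ * (1 / |w|) + 54 * (1 / |w|) + 120 / δ * (1 / |w|)
        + 66 * (1 / |w|) := by simp only [C]; ring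
      linarith [le_of_abs_le b2]
    have := mul_nonneg main (show 0 ≤ 2 / w ^ 2 by positivity)
    refine this.trans_eq ?_
    rw [hk]
    field_simp
    ring
  · intro y
    rw [hk]
    have := ((((hasDerivAt_id y).const_mul (-δ ^ 2)).add ((hasDerivAt_pow 2 y).const_mul (7 * δ))).sub
      ((hasDerivAt_pow 3 y).const_mul 11)).add ((hasDerivAt_pow 4 y).const_mul (5 / δ))
    exact this.congr_deriv (by norm_num; ring)
  · intro y
    have := ((((hasDerivAt_id y).const_mul (14 * δ)).const_add (-δ ^ 2)).sub
      ((hasDerivAt_pow 2 y).const_mul 33)).add ((hasDerivAt_pow 3 y).const_mul (20 / δ))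
    exact this.congr_deriv (by norm_num; ring)
  · intro y
    have := (((hasDerivAt_id y).const_mul 66).const_sub (14 * δ)).add
      ((hasDerivAt_pow 2 y).const_mul (60 / δ))
    exact this.congr_deriv (by norm_num; ring)
  · intro y
    have := ((hasDerivAt_id y).const_mul (120 / δ)).const_add (-66)
    exact this.congr_deriv (by norm_num)

/-- For irrational `δ` every coefficient of the tent is positive. A small multiple of `kinkMap δ`
therefore does no harm at the finitely many frequencies where its own coefficient may be negative;
it raises the mean and leaves the value at `0` unchanged. -/
theorem lt_turan_of_irrational {δ : ℝ} (h0 : 0 < δ) (h : δ < 1 / 2) (hδ : Irrational δ) :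
    δ < turan δ := by
  obtain ⟨N, hN⟩ := exists_kinkCoeff_nonneg h0
  have hev : ∀ ν ∈ Finset.Icc (-N : ℤ) N, ∀ᶠ ε in 𝓝[>] (0 : ℝ),
      0 ≤ tentCoeff δ ν + ε * kinkCoeff δ ν := by
    intro ν _
    have hpos : 0 < tentCoeff δ ν := by
      unfold tentCoeff
      split_ifs with hν
      · positivity
      · have hν' : (ν : ℝ) ≠ 0 := by exact_mod_cast hν
        have : Real.sin (Real.pi * ν * δ) ≠ 0 := by
          rw [Ne, Real.sin_eq_zero_iff]
          rintro ⟨n, hn⟩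
          have h1 : (n : ℝ) = ν * δ := by
            have := Real.pi_pos.ne'
            apply mul_left_cancel₀ this
            linarith
          exact hδ ⟨n / ν, by push_cast; rw [h1]; field_simp⟩
        have := Real.pi_pos.ne'
        positivity
    have : Tendsto (fun ε : ℝ => tentCoeff δ ν + ε * kinkCoeff δ ν) (𝓝[>] 0)
        (𝓝 (tentCoeff δ ν + 0 * kinkCoeff δ ν)) :=
      ((continuous_const.add (continuous_id.mul continuous_const)).tendsto 0).mono_left
        nhdsWithin_le_nhds
    rw [zero_mul, add_zero] at this
    exact (this.eventually (lt_mem_nhds hpos)).mono fun _ => le_of_lt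
  obtain ⟨ε, hε, hε0⟩ := (((Filter.eventually_all_finset _).2 hev).and
    self_mem_nhdsWithin).exists
  let f : C(UnitAddCircle, ℂ) := tent δ + (ε : ℂ) • kinkMap δ
  have hf : ∀ ν, coeffL ν f = ((tentCoeff δ ν + ε * kinkCoeff δ ν : ℝ) : ℂ) := by
    intro ν
    simp [f, coeffL_tent h0.le h.le, coeffL_kinkMap h0 h]
  have hfe : Feasible δ f := by
    refine ⟨fun ν => ?_, fun y hy => ?_⟩
    · rw [hf, Complex.ofReal_re]
      rcases le_or_gt |ν| N with hν | hν
      · exact hε ν (by rw [Finset.mem_Icc]; exact abs_le.1 hν)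
      · exact add_nonneg (tentCoeff_nonneg _ _) (mul_nonneg hε0.le (hN ν hν))
    · simp [f, tent_eq_zero hy.le, kinkMap_eq_zero hy.le]
  have := hfe.le_turan h
  have hf0 : f 0 = δ := by simp [f, tent_zero h0.le, kinkMap_zero h0]
  rw [hf, hf0, tentCoeff_zero, kinkCoeff_zero h0, Complex.ofReal_re, Complex.ofReal_re] at this
  have h2 : 0 < ε * (δ ^ 4 / 6) := by positivity
  nlinarith

theorem lt_turan {δ : ℝ} (h0 : 0 < δ) (h : δ < 1 / 2) (hδ : ¬ ∃ q : ℕ, 1 / δ = q) :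
    δ < turan δ := by
  by_cases hq : ∃ x : ℚ, (x : ℝ) = δ
  · obtain ⟨x, rfl⟩ := hq
    exact lt_turan_of_rat h0 h hδ
  · exact lt_turan_of_irrational h0 h hq

/-! ### Absolutely convergent Fourier series. -/

theorem norm_fourier_apply (ν : ℤ) (x : UnitAddCircle) : ‖(fourier ν x : ℂ)‖ = 1 := by
  rw [fourier_apply, Circle.norm_coe]

theorem exists_coeffL_eq {p : ℤ → ℂ} (hp : Summable fun ν => ‖p ν‖) :
    ∃ f : C(UnitAddCircle, ℂ), ∀ ν, coeffL ν f = p ν := by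
  have hs : Summable fun ν => p ν • (fourier ν : C(UnitAddCircle, ℂ)) := by
    refine Summable.of_norm ?_
    simpa [norm_smul, fourier_norm] using hp
  refine ⟨∑' ν, p ν • fourier ν, fun ν => ?_⟩
  have := (coeffL ν).hasSum hs.hasSum
  simp only [map_smul, coeffL_fourier, smul_eq_mul, mul_ite, mul_one, mul_zero] at this
  refine this.unique ?_
  simpa using hasSum_single (f := fun b => if ν = b then p b else 0) ν fun b hb => if_neg hb.symm

theorem hasSum_coeffL_mul {f : C(UnitAddCircle, ℂ)} (hf : Summable fun ν => coeffL ν f)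
    (g : C(UnitAddCircle, ℂ)) (ν : ℤ) :
    HasSum (fun m => coeffL m f * coeffL (ν - m) g) (coeffL ν (f * g)) := by
  let T : C(UnitAddCircle, ℂ) →L[ℂ] ℂ :=
    (coeffL ν).comp ((ContinuousLinearMap.mul ℂ C(UnitAddCircle, ℂ)).flip g)
  have := T.hasSum (hasSum_fourier_series_of_summable (f := f) hf)
  refine (this.congr_fun fun m => ?_)
  change _ = coeffL ν ((fourierCoeff f m • fourier m) * g)
  rw [smul_mul_assoc, map_smul, coeffL_fourier_mul, smul_eq_mul]
  rfl

theorem summable_norm_coeffL_mul {f g : C(UnitAddCircle, ℂ)}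
    (hf : Summable fun ν => ‖coeffL ν f‖) (hg : Summable fun ν => ‖coeffL ν g‖) :
    Summable fun ν => ‖coeffL ν (f * g)‖ := by
  have h1 : Summable fun x : ℤ × ℤ => ‖coeffL x.1 f‖ * ‖coeffL x.2 g‖ :=
    hf.mul_of_nonneg hg (fun _ => norm_nonneg _) (fun _ => norm_nonneg _)
  let e : ℤ × ℤ ≃ ℤ × ℤ :=
    { toFun := fun x => (x.2, x.1 - x.2)
      invFun := fun x => (x.1 + x.2, x.1)
      left_inv := fun x => by simp
      right_inv := fun x => by simp }
  -- Convolution of two absolutely summable sequences, by the change of variables `(ν, m) ↦ (m, ν -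
  -- m)`.
  have h2 : Summable fun x : ℤ × ℤ => ‖coeffL x.2 f‖ * ‖coeffL (x.1 - x.2) g‖ :=
    (e.summable_iff (f := fun x : ℤ × ℤ => ‖coeffL x.1 f‖ * ‖coeffL x.2 g‖)).2 h1
  refine Summable.of_nonneg_of_le (fun _ => norm_nonneg _) (fun ν => ?_) h2.prod
  rw [← (hasSum_coeffL_mul hf.of_norm g ν).tsum_eq]
  refine (norm_tsum_le_tsum_norm ?_).trans_eq (tsum_congr fun m => norm_mul _ _)
  simpa only [norm_mul] using h2.prod_factor ν

/-! ### Monotonicity of the Turán constant and continuity from the right. -/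

theorem turan_mono {δ δ' : ℝ} (h0 : 0 < δ) (h : δ ≤ δ') (h' : δ' < 1 / 2) : turan δ ≤ turan δ' :=
  turan_le (h.trans_lt h') (h0.le.trans (h.trans (le_turan (h0.trans_le h) h')))
    fun f _ hf hf0 => by simpa [hf0] using (hf.mono h).le_turan h'

theorem tentCoeff_neg (s : ℝ) (ν : ℤ) : tentCoeff s (-ν) = tentCoeff s ν := by
  unfold tentCoeff
  rcases eq_or_ne ν 0 with rfl | h
  · simp
  · rw [if_neg (by simpa using h), if_neg h]
    push_cast
    rw [mul_neg, neg_mul, Real.sin_neg, neg_div_neg_eq]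

theorem tentCoeff_div_sq {s : ℝ} (hs : s ≠ 0) (ν : ℤ) :
    tentCoeff s ν / s ^ 2 = Real.sinc (Real.pi * ν * s) ^ 2 := by
  unfold tentCoeff
  split_ifs with h
  · subst h; simp [hs]
  · have : (ν : ℝ) ≠ 0 := by exact_mod_cast h
    have h2 := Real.pi_pos.ne'
    rw [Real.sinc_of_ne_zero (by positivity)]
    field_simp

/-- Local averages against tents, on the Fourier side. -/
theorem hasSum_tentCoeff_mul_of_eq_zero {δ h : ℝ} (h0 : 0 ≤ h) (h2 : h ≤ 1 / 2)
    {f : C(UnitAddCircle, ℂ)} (hf : Summable fun ν => coeffL ν f)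
    (hz : ∀ x, δ < ‖x‖ → f x = 0) {y : UnitAddCircle} (hy : δ + h ≤ ‖y‖) :
    HasSum (fun ν => fourier ν y * coeffL ν f * (tentCoeff h ν : ℂ)) 0 := by
  have h3 : Summable fun ν => coeffL ν (shift y f) := by
    refine Summable.of_norm ?_
    simpa [coeffL_shift, -fourier_apply, norm_fourier_apply] using hf.norm
  have := hasSum_coeffL_mul h3 (tent h) 0
  have hp : shift y f * tent h = 0 := by
    ext x
    rw [ContinuousMap.mul_apply, shift_apply, ContinuousMap.zero_apply]
    rcases le_or_gt h ‖x‖ with hx | hx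
    · rw [tent_eq_zero hx, mul_zero]
    · rw [hz, zero_mul]
      have := norm_sub_norm_le y (-x)
      rw [norm_neg, sub_neg_eq_add, add_comm y x] at this
      linarith
  rw [hp, map_zero] at this
  simpa only [coeffL_shift, zero_sub, coeffL_tent h0 h2, tentCoeff_neg] using this

/-- Near-extremal functions for half-widths decreasing to `δ` have coefficients in `[0, 1]`, so a
subsequence converges coefficientwise. The limit is summable with sum at most `1` and defines a
function feasible for `δ` whose mean would exceed `a(δ)`. -/
theorem exists_turan_le_add {δ ε : ℝ} (h0 : 0 < δ) (h : δ < 1 / 2) (hε : 0 < ε) :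
    ∃ δ', δ < δ' ∧ δ' < 1 / 2 ∧ turan δ' ≤ turan δ + ε := by
  by_contra! hc
  obtain ⟨u, -, hu, hulim⟩ := exists_seq_strictAnti_tendsto' h
  have hb : 0 ≤ turan δ + ε := add_nonneg (h0.le.trans (le_turan h0 h)) hε.le
  choose f hf hF hf0 hfb using fun n => exists_feasible_gt (hu n).2 hb (hc (u n) (hu n).1 (hu n).2)
  let c : ℕ → ℤ → ℝ := fun n ν => (coeffL ν (f n)).re
  have hcf : ∀ n ν, coeffL ν (f n) = c n ν := fun n ν =>
    Complex.eq_re_of_ofReal_le (r := 0) (by simpa using hf n ν)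
  have hc1 : ∀ n ν, c n ν ∈ Icc (0 : ℝ) 1 := fun n ν =>
    ⟨(hF n).re_nonneg ν, by simpa [hf0 n] using (hF n).coeff_le ν⟩
  obtain ⟨d, hd, φ, hφ, hlim⟩ := (isCompact_univ_pi (fun _ : ℤ => isCompact_Icc (a := (0 : ℝ))
    (b := 1))).tendsto_subseq (x := c) (fun n => by rw [mem_univ_pi]; exact hc1 n)
  rw [tendsto_pi_nhds] at hlim
  simp only [mem_univ_pi] at hd
  have hd0 : ∀ ν, 0 ≤ d ν := fun ν => (hd ν).1
  have hdsum : ∀ s : Finset ℤ, ∑ ν ∈ s, d ν ≤ 1 := by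
    intro s
    refine le_of_tendsto' (tendsto_finsetSum s fun ν _ => hlim ν) fun n => ?_
    have := sum_le_hasSum s (fun ν _ => (hF (φ n)).re_nonneg ν) (hF (φ n)).hasSum
    simpa [hf0] using this
  have hds : Summable d := summable_of_sum_le hd0 hdsum
  have hds' : Summable fun ν => ‖(d ν : ℂ)‖ := by
    simpa [abs_of_nonneg (hd0 _)] using hds
  obtain ⟨G, hG⟩ := exists_coeffL_eq hds'
  have hGs : Summable fun ν => coeffL ν G := by simpa only [hG] using hds'.of_norm
  have hGF : Feasible δ G := by
    refine ⟨fun ν => by rw [hG]; exact hd0 ν, fun y hy => ?_⟩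
    -- Coefficientwise convergence need not give pointwise convergence. Averaging against a tent
    -- inserts the summable weights `tentCoeff s`, which makes dominated convergence available; the
    -- width `s` is sent to `0` only afterwards.
    have key : ∀ s : ℝ, 0 < s → s ≤ 1 / 2 → δ + s < ‖y‖ →
        ∑' ν, fourier ν y * (d ν : ℂ) * (tentCoeff s ν : ℂ) = 0 := by
      intro s hs0 hs1 hs2
      have ht : Tendsto (fun n => ∑' ν, fourier ν y * (c (φ n) ν : ℂ) * (tentCoeff s ν : ℂ)) atTop
          (𝓝 (∑' ν, fourier ν y * (d ν : ℂ) * (tentCoeff s ν : ℂ))) := by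
        refine tendsto_tsum_of_dominated_convergence (hasSum_tentCoeff hs0.le hs1).summable
          (fun ν => ?_) (Eventually.of_forall fun n ν => ?_)
        · exact ((Complex.continuous_ofReal.tendsto _).comp (hlim ν)).const_mul _ |>.mul_const _
        · rw [norm_mul, norm_mul, norm_fourier_apply, one_mul, Complex.norm_real,
            Complex.norm_real, Real.norm_eq_abs, Real.norm_eq_abs,
            abs_of_nonneg (tentCoeff_nonneg s ν), abs_of_nonneg (hc1 _ _).1]
          exact mul_le_of_le_one_left (tentCoeff_nonneg s ν) (hc1 _ _).2
      refine tendsto_nhds_unique ht (tendsto_const_nhds.congr' ?_)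
      have hev : ∀ᶠ n in atTop, u (φ n) < ‖y‖ - s :=
        (hulim.comp hφ.tendsto_atTop).eventually (gt_mem_nhds (by linarith))
      filter_upwards [hev] with n hn
      have := hasSum_tentCoeff_mul_of_eq_zero hs0.le hs1 (summable_coeffL (hf (φ n)))
        (hF (φ n)).eq_zero (y := y) (by linarith)
      simp only [hcf] at this
      exact this.tsum_eq.symm
    have ht : Tendsto (fun s : ℝ => ∑' ν, fourier ν y * (d ν : ℂ) *
        ((Real.sinc (Real.pi * ν * s) ^ 2 : ℝ) : ℂ)) (𝓝[>] 0)
        (𝓝 (∑' ν, fourier ν y * (d ν : ℂ) * ((Real.sinc (Real.pi * ν * 0) ^ 2 : ℝ) : ℂ))) := by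
      refine tendsto_tsum_of_dominated_convergence hds (fun ν => ?_)
        (Eventually.of_forall fun s ν => ?_)
      · have : Continuous fun s : ℝ => fourier ν y * (d ν : ℂ) *
            ((Real.sinc (Real.pi * ν * s) ^ 2 : ℝ) : ℂ) := by
          have := Real.continuous_sinc
          fun_prop
        exact (this.tendsto 0).mono_left nhdsWithin_le_nhds
      · rw [norm_mul, norm_mul, norm_fourier_apply, one_mul, Complex.norm_real,
          Complex.norm_real, Real.norm_eq_abs, Real.norm_eq_abs, abs_of_nonneg (hd0 ν), abs_pow]
        exact mul_le_of_le_one_right (hd0 ν) (pow_le_one₀ (abs_nonneg _) (Real.abs_sinc_le_one _))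
    have hGy : ∑' ν, fourier ν y * (d ν : ℂ) * ((Real.sinc (Real.pi * ν * 0) ^ 2 : ℝ) : ℂ) = G y := by
      rw [← (hasSum_coeffL_apply hGs y).tsum_eq]
      refine tsum_congr fun ν => ?_
      rw [hG]; simp [mul_comm]
    rw [hGy] at ht
    refine tendsto_nhds_unique ht (tendsto_const_nhds.congr' ?_)
    have hI : Ioo (0 : ℝ) (min (1 / 2) (‖y‖ - δ)) ∈ 𝓝[>] (0 : ℝ) :=
      Ioo_mem_nhdsGT (lt_min (by norm_num) (by linarith))
    filter_upwards [hI] with s hs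
    have h1 := key s hs.1 (hs.2.le.trans (min_le_left _ _))
      (by linarith [hs.2.trans_le (min_le_right _ _)])
    have h2 : ∀ ν, fourier ν y * (d ν : ℂ) * ((Real.sinc (Real.pi * ν * s) ^ 2 : ℝ) : ℂ) =
        fourier ν y * (d ν : ℂ) * (tentCoeff s ν : ℂ) * ((s : ℂ) ^ 2)⁻¹ := by
      intro ν
      rw [← tentCoeff_div_sq hs.1.ne']; push_cast; rw [div_eq_mul_inv]; ring
    simp only [h2, tsum_mul_right, h1, zero_mul]
  have h1 := hGF.le_turan h
  have h2 : (G 0).re ≤ 1 := by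
    have := hGF.hasSum
    simp only [hG, Complex.ofReal_re] at this
    rw [← this.tsum_eq]
    exact hds.tsum_le_of_sum_le hdsum
  have h3 : turan δ + ε ≤ d 0 := ge_of_tendsto' (hlim 0) fun n => (hfb (φ n)).le
  rw [hG, Complex.ofReal_re] at h1
  have h4 := mul_le_mul_of_nonneg_left h2 (h0.le.trans (le_turan h0 h))
  linarith

/-! ### Continuity from the left. -/

theorem norm_coe_le_abs (y : ℝ) : ‖(y : UnitAddCircle)‖ ≤ |y| := by
  rw [UnitAddCircle.norm_eq]
  simpa using round_le y 0

theorem norm_coe_eq_min {y : ℝ} (h : |y| ≤ 1) : ‖(y : UnitAddCircle)‖ = min |y| (1 - |y|) := by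
  rcases le_total |y| (1 / 2) with h2 | h2
  · rw [norm_coe_of_abs_le h2, min_eq_left (by linarith)]
  · rw [min_eq_right (by linarith)]
    rcases abs_cases y with ⟨e, _⟩ | ⟨e, _⟩
    · have : (y : UnitAddCircle) = ((y - 1 : ℝ) : UnitAddCircle) := by
        rw [← AddCircle.coe_add_period (1 : ℝ) (y - 1)]; simp
      rw [e] at h h2 ⊢
      have e2 : |y - 1| = 1 - y := by rw [abs_of_nonpos (by linarith)]; ring
      rw [this, norm_coe_of_abs_le (by rw [e2]; linarith), e2]
    · have : (y : UnitAddCircle) = ((y + 1 : ℝ) : UnitAddCircle) :=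
        (AddCircle.coe_add_period (1 : ℝ) y).symm
      rw [e] at h h2 ⊢
      have e2 : |y + 1| = 1 - -y := by rw [abs_of_nonneg (by linarith)]; ring
      rw [this, norm_coe_of_abs_le (by rw [e2]; linarith), e2]

/-- Moving the right end of the arc inward by `t` brings it into the arc of half-width `δ - t`. The
condition `2h ≤ 1 - 2δ` keeps the neighbourhood of `δ` from reaching the left end across the
complementary arc. -/
theorem norm_sub_le_of_near {δ h t : ℝ} (hh1 : 4 * h ≤ δ) (hh2 : 2 * h ≤ 1 - 2 * δ)
    (ht : 2 * t ≤ δ) {x : UnitAddCircle} (hx : ‖x‖ ≤ δ)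
    (hn : ‖x - (δ : UnitAddCircle)‖ < 2 * h) : ‖x - (t : UnitAddCircle)‖ ≤ δ - t := by
  obtain ⟨y, rfl, hy⟩ := exists_coe_abs_eq_norm x
  rw [← hy] at hx
  have hy' := abs_le.1 hx
  rw [← AddCircle.coe_sub] at hn ⊢
  have e : |y - δ| = δ - y := by rw [abs_of_nonpos (by linarith)]; ring
  have hh := (norm_nonneg _).trans_lt hn
  rw [norm_coe_eq_min (by rw [e]; linarith), e, min_lt_iff] at hn
  refine (norm_coe_le_abs _).trans (abs_le.2 ⟨?_, by linarith⟩)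
  rcases hn with hn | hn <;> linarith

/-- In the outer layer exactly one of the two cut-off functions equals `1` and the other equals `0`,
so the middle piece of the decomposition vanishes there. -/
theorem near_of_lt_norm {δ h t : ℝ} (hh1 : 4 * h ≤ δ) (hh2 : 2 * h ≤ 1 - 2 * δ)
    (ht1 : t ≤ h) (ht0 : 0 < t) {x : UnitAddCircle}
    (hx : ‖x‖ ≤ δ) (hn : δ - t < ‖x‖) :
    (‖x - (δ : UnitAddCircle)‖ ≤ h ∧ 2 * h ≤ ‖x + (δ : UnitAddCircle)‖) ∨
    (‖x + (δ : UnitAddCircle)‖ ≤ h ∧ 2 * h ≤ ‖x - (δ : UnitAddCircle)‖) := by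
  obtain ⟨y, rfl, hy⟩ := exists_coe_abs_eq_norm x
  rw [← hy] at hx hn
  rw [← AddCircle.coe_sub, ← AddCircle.coe_add]
  rcases abs_cases y with ⟨e, _⟩ | ⟨e, _⟩
  · rw [e] at hx hn
    refine Or.inl ⟨(norm_coe_le_abs _).trans (abs_le.2 ⟨by linarith, by linarith⟩), ?_⟩
    have e : |y + δ| = y + δ := abs_of_nonneg (by linarith)
    rw [norm_coe_eq_min (by rw [e]; linarith), e]
    exact le_min (by linarith) (by linarith)
  · rw [e] at hx hn
    refine Or.inr ⟨(norm_coe_le_abs _).trans (abs_le.2 ⟨by linarith, by linarith⟩), ?_⟩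
    have e : |y - δ| = δ - y := by rw [abs_of_nonpos (by linarith)]; ring
    rw [norm_coe_eq_min (by rw [e]; linarith), e]
    exact le_min (by linarith) (by linarith)

/-- The trapezoid function equal to `1` for `‖x‖ ≤ h` and to `0` for `‖x‖ ≥ 2h`. -/
def trapezoid (h : ℝ) : C(UnitAddCircle, ℂ) := ((h⁻¹ : ℝ) : ℂ) • (tent (2 * h) - tent h)

theorem trapezoid_eq_one {h : ℝ} (h0 : 0 < h) {x : UnitAddCircle} (hx : ‖x‖ ≤ h) :
    trapezoid h x = 1 := by
  have : (h : ℂ) ≠ 0 := by exact_mod_cast h0.ne'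
  simp only [trapezoid, ContinuousMap.smul_apply, ContinuousMap.sub_apply, tent_apply, smul_eq_mul]
  rw [max_eq_right (by linarith), max_eq_right (by linarith)]
  push_cast
  field_simp
  ring

theorem trapezoid_eq_zero {h : ℝ} (h0 : 0 < h) {x : UnitAddCircle} (hx : 2 * h ≤ ‖x‖) :
    trapezoid h x = 0 := by
  simp [trapezoid, tent_eq_zero hx, tent_eq_zero (s := h) (x := x) (by linarith)]

theorem summable_coeffL_trapezoid {h : ℝ} (h0 : 0 < h) (h1 : 2 * h ≤ 1 / 2) :
    Summable fun ν => ‖coeffL ν (trapezoid h)‖ := by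
  have hs := ((hasSum_tentCoeff (s := 2 * h) (by linarith) h1).summable.add
    (hasSum_tentCoeff (s := h) h0.le (by linarith)).summable).mul_left (h⁻¹)
  refine Summable.of_nonneg_of_le (fun _ => norm_nonneg _) (fun ν => ?_) hs
  rw [trapezoid, map_smul, map_sub, coeffL_tent (by linarith) h1,
    coeffL_tent h0.le (by linarith), smul_eq_mul, norm_mul, Complex.norm_real,
    Real.norm_of_nonneg (inv_nonneg.2 h0.le)]
  gcongr
  refine (norm_sub_le _ _).trans_eq ?_
  simp only [Complex.norm_real, Real.norm_of_nonneg (tentCoeff_nonneg _ _)]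

theorem summable_coeffL_shift {f : C(UnitAddCircle, ℂ)} (hf : Summable fun ν => ‖coeffL ν f‖)
    (y : UnitAddCircle) : Summable fun ν => ‖coeffL ν (shift y f)‖ := by
  simpa [coeffL_shift, -fourier_apply, norm_fourier_apply] using hf

/-- Translations act continuously on absolutely convergent Fourier series. -/
theorem tendsto_tsum_norm_mul_fourier_sub_one {p : ℤ → ℂ} (hp : Summable fun ν => ‖p ν‖) :
    Tendsto (fun t : UnitAddCircle => ∑' ν, ‖p ν‖ * ‖fourier ν t - 1‖) (𝓝 0) (𝓝 0) := by
  have : Tendsto (fun t : UnitAddCircle => ∑' ν, ‖p ν‖ * ‖fourier ν t - 1‖) (𝓝 0)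
      (𝓝 (∑' ν : ℤ, ‖p ν‖ * ‖fourier ν (0 : UnitAddCircle) - 1‖)) := by
    refine tendsto_tsum_of_dominated_convergence (hp.mul_right 2) (fun ν => ?_)
      (Eventually.of_forall fun t ν => ?_)
    · have : Continuous fun t : UnitAddCircle => ‖p ν‖ * ‖fourier ν t - 1‖ := by fun_prop
      exact this.tendsto 0
    · rw [Real.norm_of_nonneg (by positivity)]
      gcongr
      refine (norm_sub_le _ _).trans_eq ?_
      rw [norm_fourier_apply, norm_one]; norm_num
  simpa [fourier_eval_zero, -fourier_apply] using this

/-- Absolutely convergent perturbations can be dominated by a positive definite function with small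
support. -/
theorem exists_dominating {s : ℝ} (hs : 0 < s) (hs' : s ≤ 1 / 2) {e : ℤ → ℝ} (he0 : ∀ ν, 0 ≤ e ν)
    (he : Summable e) :
    ∃ g : C(UnitAddCircle, ℂ), (∀ ν, e ν ≤ (coeffL ν g).re) ∧ (∀ x, s < ‖x‖ → g x = 0) ∧
      (g 0).re = s⁻¹ * ∑' ν, e ν := by
  obtain ⟨E, hE⟩ := exists_coeffL_eq (p := fun ν => (e ν : ℂ))
    (by simpa [abs_of_nonneg (he0 _)] using he)
  have hEs : Summable fun ν => coeffL ν E := by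
    simpa only [hE] using (Complex.hasSum_ofReal.2 he.hasSum).summable
  -- Multiplication by the tent convolves `e` with the nonnegative sequence `tentCoeff s`; its
  -- central term alone gives `s² e ν`, hence the factor `s⁻²`.
  refine ⟨(((s ^ 2)⁻¹ : ℝ) : ℂ) • (E * tent s), fun ν => ?_, fun x hx => ?_, ?_⟩
  · have h1 := Complex.hasSum_re (hasSum_coeffL_mul hEs (tent s) ν)
    simp only [hE, coeffL_tent hs.le hs', ← Complex.ofReal_mul, Complex.ofReal_re] at h1
    have h2 := le_hasSum h1 ν fun m _ => mul_nonneg (he0 m) (tentCoeff_nonneg _ _)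
    rw [sub_self, tentCoeff_zero] at h2
    rw [map_smul, smul_eq_mul, Complex.re_ofReal_mul, le_inv_mul_iff₀ (by positivity)]
    linarith
  · simp [tent_eq_zero hx.le]
  · have hE0 : E 0 = ((∑' ν, e ν : ℝ) : ℂ) := by
      rw [← (hasSum_coeffL_apply hEs 0).tsum_eq, Complex.ofReal_tsum]
      simp [hE, fourier_eval_zero, -fourier_apply]
    rw [ContinuousMap.smul_apply, ContinuousMap.mul_apply, hE0, tent_zero hs.le, smul_eq_mul,
      ← Complex.ofReal_mul, ← Complex.ofReal_mul, Complex.ofReal_re]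
    field_simp

/-- Cut a near-extremal `f` into two end pieces and a middle, and translate the ends inward by `t`.
The end pieces have absolutely convergent Fourier series, so the total change of the coefficients
tends to `0` with `t`. A positive definite function supported near `0` compensates for it, at a cost
in the value at `0` that also tends to `0`. -/
theorem exists_le_turan_add {δ ε : ℝ} (h0 : 0 < δ) (h : δ < 1 / 2) (hε : 0 < ε) :
    ∃ δ', 0 < δ' ∧ δ' < δ ∧ turan δ ≤ turan δ' + ε := by
  by_contra! hc
  set b : ℝ := turan δ - ε with hb
  have hb0 : 0 ≤ b := by
    have := hc (δ / 2) (by linarith) (by linarith)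
    have := le_turan (δ := δ / 2) (by linarith) (by linarith)
    linarith
  obtain ⟨f, hfp, hf, hf0, hfb⟩ := exists_feasible_gt h hb0 (by linarith)
  have hfs : Summable fun ν => ‖coeffL ν f‖ := (summable_coeffL hfp).norm
  obtain ⟨r, hr0, hr1, hr2⟩ : ∃ r : ℝ, 0 < r ∧ 4 * r ≤ δ ∧ 2 * r ≤ 1 - 2 * δ :=
    ⟨min (δ / 4) ((1 - 2 * δ) / 2), lt_min (by linarith) (by linarith),
      by linarith [min_le_left (δ / 4) ((1 - 2 * δ) / 2)],
      by linarith [min_le_right (δ / 4) ((1 - 2 * δ) / 2)]⟩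
  have hts := summable_coeffL_trapezoid hr0 (by linarith)
  let χR := shift (-(δ : UnitAddCircle)) (trapezoid r)
  let χL := shift (δ : UnitAddCircle) (trapezoid r)
  let fR := f * χR
  let fL := f * χL
  have hR : Summable fun ν => ‖coeffL ν fR‖ :=
    summable_norm_coeffL_mul hfs (summable_coeffL_shift hts _)
  have hL : Summable fun ν => ‖coeffL ν fL‖ :=
    summable_norm_coeffL_mul hfs (summable_coeffL_shift hts _)
  let e : UnitAddCircle → ℤ → ℝ := fun t ν =>
    ‖coeffL ν fR‖ * ‖fourier ν t - 1‖ + ‖coeffL ν fL‖ * ‖fourier ν (-t) - 1‖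
  have hsum : ∀ (p : ℤ → ℂ), (Summable fun ν => ‖p ν‖) → ∀ t : UnitAddCircle,
      Summable fun ν => ‖p ν‖ * ‖fourier ν t - 1‖ := fun p hp t =>
    Summable.of_nonneg_of_le (fun ν => by positivity) (fun ν => by
      gcongr
      refine (norm_sub_le _ _).trans_eq ?_
      rw [norm_fourier_apply, norm_one]; norm_num) (hp.mul_right 2)
  have he0 : ∀ t ν, 0 ≤ e t ν := fun t ν => by positivity
  have hes : ∀ t, Summable (e t) := fun t => (hsum _ hR t).add (hsum _ hL (-t))
  have het : Tendsto (fun t => ∑' ν, e t ν) (𝓝 0) (𝓝 0) := by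
    have h1 := tendsto_tsum_norm_mul_fourier_sub_one hR
    have h2 := (tendsto_tsum_norm_mul_fourier_sub_one hL).comp
      (show Tendsto (fun t : UnitAddCircle => -t) (𝓝 0) (𝓝 0) by
        simpa using (continuous_neg (G := UnitAddCircle)).tendsto 0)
    have h3 := h1.add h2
    rw [add_zero] at h3
    refine h3.congr fun t => ?_
    exact ((hsum _ hR t).tsum_add (hsum _ hL (-t))).symm
  choose g hg1 hg2 hg3 using fun t => exists_dominating (s := δ / 4) (by linarith) (by linarith)
    (he0 t) (hes t)
  -- Each coefficient of `F t` has real part at least that of `f`, the support shrinks to `[-(δ -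
  -- t), δ - t]`, and the value at `0` tends to `1`.
  let F : UnitAddCircle → C(UnitAddCircle, ℂ) := fun t =>
    shift t fR + shift (-t) fL + (f - fR - fL) + g t
  have hFc : ∀ t ν, (coeffL ν f).re ≤ (coeffL ν (F t)).re := by
    intro t ν
    have h1 : coeffL ν (F t) = coeffL ν f + coeffL ν fR * (fourier ν t - 1) +
        coeffL ν fL * (fourier ν (-t) - 1) + coeffL ν (g t) := by
      simp only [F, map_add, map_sub, coeffL_shift]; ring
    have h2 := neg_le_of_abs_le ((Complex.abs_re_le_norm _).trans_eq
      (norm_mul (coeffL ν fR) (fourier ν t - 1)))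
    have h3 := neg_le_of_abs_le ((Complex.abs_re_le_norm _).trans_eq
      (norm_mul (coeffL ν fL) (fourier ν (-t) - 1)))
    have h4 := hg1 t ν
    rw [h1, Complex.add_re, Complex.add_re, Complex.add_re]
    simp only [e] at h4
    linarith
  have hFf : ∀ t : ℝ, 0 < t → t ≤ r → Feasible (δ - t) (F t) := by
    intro t ht0 htr
    refine ⟨fun ν => (hf.re_nonneg ν).trans (hFc _ ν), fun x hx => ?_⟩
    have hgx : g t x = 0 := hg2 _ x (by linarith)
    have e1 : fR (x + t) = 0 := by
      rcases le_or_gt ‖x + (t : UnitAddCircle)‖ δ with h1 | h1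
      · have : trapezoid r (x + t - δ) = 0 := by
          refine trapezoid_eq_zero hr0 ?_
          by_contra! h2
          have := norm_sub_le_of_near hr1 hr2 (t := t) (by linarith) h1 h2
          rw [add_sub_cancel_right] at this
          linarith
        simp [fR, χR, ← sub_eq_add_neg, this]
      · simp [fR, hf.eq_zero _ h1]
    have e2 : fL (x + -t) = 0 := by
      rcases le_or_gt ‖x + -(t : UnitAddCircle)‖ δ with h1 | h1
      · have : trapezoid r (x + -t + δ) = 0 := by
          refine trapezoid_eq_zero hr0 ?_
          by_contra! h2
          have := norm_sub_le_of_near (x := -(x + -(t : UnitAddCircle))) hr1 hr2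
            (t := t) (by linarith) (by rwa [norm_neg])
            (by rwa [← norm_neg, show -(-(x + -(t : UnitAddCircle)) - δ) = x + -t + δ by abel])
          rw [← norm_neg] at this
          have e3 : -(-(x + -(t : UnitAddCircle)) - t) = x := by abel
          rw [e3] at this
          linarith
        simp [fL, χL, this]
      · simp [fL, hf.eq_zero _ h1]
    have e3 : f x - fR x - fL x = 0 := by
      rcases le_or_gt ‖x‖ δ with h1 | h1
      · rcases near_of_lt_norm hr1 hr2 htr ht0 h1 hx with ⟨h2, h3⟩ | ⟨h2, h3⟩
        · simp [fR, fL, χR, χL, ← sub_eq_add_neg, trapezoid_eq_one hr0 h2, trapezoid_eq_zero hr0 h3]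
        · simp [fR, fL, χR, χL, ← sub_eq_add_neg, trapezoid_eq_one hr0 h2, trapezoid_eq_zero hr0 h3]
      · simp [fR, fL, hf.eq_zero _ h1]
    simp only [F, ContinuousMap.add_apply, ContinuousMap.sub_apply, shift_apply, e1, e2, e3, hgx,
      add_zero]
  have hlim : Tendsto (fun t : ℝ => b * (F t 0).re) (𝓝[>] 0) (𝓝 (b * 1)) := by
    have hcoe : Tendsto (fun t : ℝ => (t : UnitAddCircle)) (𝓝[>] 0) (𝓝 0) :=
      (continuous_coe_unitAddCircle.tendsto' 0 0 (by simp)).mono_left nhdsWithin_le_nhds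
    have h1 : Tendsto (fun t : UnitAddCircle => (fR t + fL (-t) + (f 0 - fR 0 - fL 0)).re) (𝓝 0)
        (𝓝 ((fR 0 + fL (-0) + (f 0 - fR 0 - fL 0)).re)) :=
      Continuous.tendsto (by fun_prop) 0
    have h2 := ((h1.add (het.const_mul (δ / 4)⁻¹)).comp hcoe).const_mul b
    have e1 : (fR 0 + fL (-0) + (f 0 - fR 0 - fL 0)).re + (δ / 4)⁻¹ * 0 = 1 := by
      rw [neg_zero, show fR 0 + fL 0 + (f 0 - fR 0 - fL 0) = f 0 by ring, hf0]; simp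
    rw [e1] at h2
    refine h2.congr fun t => ?_
    simp only [F, Function.comp_apply, ContinuousMap.add_apply, ContinuousMap.sub_apply,
      shift_apply, zero_add, Complex.add_re (_ + _ + _) (g t 0), hg3]
  have hle : (coeffL 0 f).re ≤ b * 1 := by
    refine ge_of_tendsto hlim ?_
    filter_upwards [Ioc_mem_nhdsGT hr0] with t ht
    have h1 := (hFf t ht.1 ht.2).le_turan (by linarith [ht.1])
    refine (hFc t 0).trans (h1.trans ?_)
    gcongr
    · exact (hFf t ht.1 ht.2).apply_nonneg
    · linarith [hc (δ - t) (by linarith [ht.2]) (by linarith [ht.1])]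
  linarith

theorem continuousOn_turan : ContinuousOn turan (Ioo 0 (1 / 2)) := by
  intro δ hδ
  refine ContinuousAt.continuousWithinAt ?_
  rw [Metric.continuousAt_iff']
  intro ε hε
  obtain ⟨a, ha0, haδ, ha⟩ := exists_le_turan_add hδ.1 hδ.2 (half_pos hε)
  obtain ⟨b, hbδ, hb1, hb⟩ := exists_turan_le_add hδ.1 hδ.2 (half_pos hε)
  filter_upwards [Ioo_mem_nhds haδ hbδ] with x hx
  have h1 := turan_mono ha0 hx.1.le (hx.2.trans hb1)
  have h2 := turan_mono (ha0.trans hx.1) hx.2.le hb1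
  rw [Real.dist_eq, abs_lt]
  constructor <;> linarith

/-! ### Fourier analysis on the torus. -/

open UnitAddTorus

variable {n : ℕ}

instance : IsProbabilityMeasure (volume : Measure (Torus n)) := by
  rw [← pi_haarAddCircle]; infer_instance

theorem norm_mFourier_apply (ν : Fin n → ℤ) (x : Torus n) : ‖mFourier ν x‖ = 1 := by
  simp [mFourier, norm_prod, norm_fourier_apply, -fourier_apply]

theorem mFourier_single_apply (i : Fin n) (m : ℤ) (x : Torus n) :
    mFourier (Pi.single i m) x = fourier m (x i) := by
  rw [mFourier, ContinuousMap.coe_mk, Finset.prod_eq_single i]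
  · rw [Pi.single_eq_same]
  · intro j _ hj
    rw [Pi.single_eq_of_ne hj, fourier_zero]
  · simp

theorem integrable_mFourier_mul {F : Torus n → ℂ} (hF : Integrable F) (ν : Fin n → ℤ) :
    Integrable fun x => mFourier ν x * F x :=
  hF.bdd_mul (c := 1) (mFourier ν).continuous.aestronglyMeasurable
    (ae_of_all _ fun x => (norm_mFourier_apply ν x).le)

theorem integrable_mul_comp {F : Torus n → ℂ} (hF : Integrable F) (g : C(UnitAddCircle, ℂ))
    (i : Fin n) : Integrable fun x => F x * g (x i) :=
  hF.mul_bdd (c := ‖g‖) (Continuous.aestronglyMeasurable (by fun_prop))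
    (ae_of_all _ fun x => g.norm_coe_le_norm _)

theorem hasSum_mFourierCoeff_mul_comp {F : Torus n → ℂ} (hF : Integrable F)
    {g : C(UnitAddCircle, ℂ)} (hg : Summable fun m => coeffL m g) (i : Fin n) (ν : Fin n → ℤ) :
    HasSum (fun m : ℤ => coeffL m g * mFourierCoeff F (ν - Pi.single i m))
      (mFourierCoeff (fun x => F x * g (x i)) ν) := by
  let H : ℤ → Torus n → ℂ := fun m x => coeffL m g * (mFourier (-(ν - Pi.single i m)) x * F x)
  have hn : ∀ m : ℤ, ∫ x, ‖H m x‖ = ‖coeffL m g‖ * ∫ x, ‖F x‖ := by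
    intro m
    rw [← integral_const_mul]
    refine integral_congr_ae (ae_of_all _ fun x => ?_)
    simp only [H]
    rw [norm_mul, norm_mul, norm_mFourier_apply, one_mul]
  have hs : Summable fun m : ℤ => ∫ x, ‖H m x‖ := by
    simp only [hn]
    exact Summable.mul_right (∫ x, ‖F x‖) hg.norm
  have hi : ∀ m, Integrable (H m) := fun m => (integrable_mFourier_mul hF _).const_mul _
  have h := hasSum_integral_of_summable_integral_norm hi hs
  have h1 : ∀ m, ∫ x, H m x = coeffL m g * mFourierCoeff F (ν - Pi.single i m) := by
    intro m
    rw [mFourierCoeff_eq_integral_volume, ← integral_const_mul]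
  have h2 : ∫ x, ∑' m, H m x = mFourierCoeff (fun x => F x * g (x i)) ν := by
    rw [mFourierCoeff_eq_integral_volume]
    refine integral_congr_ae (ae_of_all _ fun x => ?_)
    have h3 := ((hasSum_coeffL_apply hg (x i)).mul_left (mFourier (-ν) x * F x)).tsum_eq
    simp only [H]
    rw [← mul_assoc, ← h3]
    refine tsum_congr fun m => ?_
    rw [neg_sub, sub_eq_add_neg, mFourier_add, mFourier_single_apply]
    ring
  rw [h2] at h
  simpa only [h1] using h

/-- All terms of the convolution series are nonnegative; only the one with `m = 0` is kept. -/
theorem le_mFourierCoeff_mul_comp {F : Torus n → ℂ} (hF : Integrable F)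
    (hF0 : ∀ ν, 0 ≤ mFourierCoeff F ν) {g : C(UnitAddCircle, ℂ)} (hg : ∀ m, 0 ≤ coeffL m g)
    (i : Fin n) (ν : Fin n → ℤ) :
    coeffL 0 g * mFourierCoeff F ν ≤ mFourierCoeff (fun x => F x * g (x i)) ν := by
  have h := le_hasSum (hasSum_mFourierCoeff_mul_comp hF (summable_coeffL hg) i ν) 0
    fun m _ => mul_nonneg (hg m) (hF0 _)
  simpa using h

theorem le_mFourierCoeff_mul_prod {F : Torus n → ℂ} (hF : Integrable F)
    (hF0 : ∀ ν, 0 ≤ mFourierCoeff F ν) {g : C(UnitAddCircle, ℂ)} (hg : ∀ m, 0 ≤ coeffL m g)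
    (s : Finset (Fin n)) :
    Integrable (fun x => F x * ∏ i ∈ s, g (x i)) ∧
      ∀ ν, coeffL 0 g ^ s.card * mFourierCoeff F ν ≤
        mFourierCoeff (fun x => F x * ∏ i ∈ s, g (x i)) ν := by
  induction s using Finset.induction_on with
  | empty => simpa using hF
  | insert i s his ih =>
    have e : (fun x : Torus n => F x * ∏ j ∈ insert i s, g (x j)) =
        fun x => (F x * ∏ j ∈ s, g (x j)) * g (x i) := by
      ext x; rw [Finset.prod_insert his]; ring
    rw [e]
    refine ⟨integrable_mul_comp ih.1 g i, fun ν => ?_⟩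
    have h0 : ∀ ν, 0 ≤ mFourierCoeff (fun x => F x * ∏ j ∈ s, g (x j)) ν := fun ν =>
      (mul_nonneg (pow_nonneg (hg 0) _) (hF0 ν)).trans (ih.2 ν)
    refine le_trans ?_ (le_mFourierCoeff_mul_comp ih.1 h0 hg i ν)
    rw [Finset.card_insert_of_notMem his, pow_succ', mul_assoc]
    exact mul_le_mul_of_nonneg_left (ih.2 ν) (hg 0)

/-- Integrable functions on the torus are determined by their Fourier coefficients. -/
theorem ae_eq_zero_of_mFourierCoeff_eq_zero {F : Torus n → ℂ} (hF : Integrable F)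
    (h0 : ∀ ν, mFourierCoeff F ν = 0) : F =ᵐ[volume] 0 := by
  have hmul : ∀ φ : C(Torus n, ℂ), Integrable fun x => φ x * F x := fun φ =>
    hF.bdd_mul (c := ‖φ‖) φ.continuous.aestronglyMeasurable
      (ae_of_all _ fun x => φ.norm_coe_le_norm x)
  let T : C(Torus n, ℂ) →L[ℂ] ℂ := LinearMap.mkContinuous
    { toFun := fun φ => ∫ x, φ x * F x
      map_add' := fun φ ψ => by
        simp only [ContinuousMap.add_apply, add_mul]
        exact integral_add (hmul φ) (hmul ψ)
      map_smul' := fun c φ => by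
        simp only [ContinuousMap.smul_apply, smul_eq_mul, mul_assoc, RingHom.id_apply]
        exact integral_const_mul _ _ } (∫ x, ‖F x‖) (fun φ => by
      rw [mul_comm, ← integral_const_mul]
      refine norm_integral_le_of_norm_le (hF.norm.const_mul _) (ae_of_all _ fun x => ?_)
      rw [norm_mul]
      gcongr
      exact φ.norm_coe_le_norm x)
  have hT : ∀ φ, T φ = 0 := by
    have hle : (Submodule.span ℂ (range (mFourier (d := Fin n)))).topologicalClosure ≤
        LinearMap.ker (T : C(Torus n, ℂ) →ₗ[ℂ] ℂ) := by
      refine Submodule.topologicalClosure_minimal _ (Submodule.span_le.2 ?_) T.isClosed_ker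
      rintro _ ⟨ν, rfl⟩
      have := h0 (-ν)
      rw [mFourierCoeff_eq_integral_volume, neg_neg] at this
      exact this
    rw [span_mFourier_closure_eq_top] at hle
    exact fun φ => hle Submodule.mem_top
  refine ae_eq_zero_of_forall_setIntegral_isClosed_eq_zero hF fun s hs => ?_
  -- Trigonometric density makes `F` annihilate continuous functions; bounded continuous
  -- approximations of the indicator extend this to closed sets.
  have h1 : Tendsto (fun k => ∫ x, (hs.apprSeq k x : ℂ) * F x) atTop
      (𝓝 (∫ x, s.indicator (fun _ => (1 : ℂ)) x * F x)) := by
    refine tendsto_integral_of_dominated_convergence (fun x => ‖F x‖) (fun k => ?_) hF.norm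
      (fun k => ae_of_all _ fun x => ?_) (ae_of_all _ fun x => ?_)
    · refine AEStronglyMeasurable.mul (Continuous.aestronglyMeasurable ?_) hF.aestronglyMeasurable
      have := (hs.apprSeq k).continuous
      fun_prop
    · rw [norm_mul]
      refine mul_le_of_le_one_left (norm_nonneg _) ?_
      simpa using HasOuterApproxClosed.apprSeq_apply_le_one hs k x
    · refine Tendsto.mul_const _ ?_
      have h2 := (tendsto_pi_nhds.1 (HasOuterApproxClosed.tendsto_apprSeq hs)) x
      have h3 : Continuous fun r : NNReal => (r : ℂ) := by fun_prop
      have h4 := (h3.tendsto _).comp h2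
      have e : ((s.indicator (fun _ => (1 : NNReal)) x : NNReal) : ℂ) =
          s.indicator (fun _ => (1 : ℂ)) x := by
        by_cases hx : x ∈ s <;> simp [hx]
      rw [e] at h4
      exact h4
  have h4 : ∀ k, ∫ x, (hs.apprSeq k x : ℂ) * F x = 0 := fun k => by
    have := (hs.apprSeq k).continuous
    exact hT ⟨fun x => (hs.apprSeq k x : ℂ), by fun_prop⟩
  simp only [h4] at h1
  have h5 := tendsto_nhds_unique tendsto_const_nhds h1
  rw [← integral_indicator hs.measurableSet, h5]
  congr 1
  ext x
  by_cases hx : x ∈ s <;> simp [hx]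

theorem mFourierCoeff_congr_ae {f g : Torus n → ℂ} (h : f =ᵐ[volume] g) (ν : Fin n → ℤ) :
    mFourierCoeff f ν = mFourierCoeff g ν := by
  simp only [mFourierCoeff_eq_integral_volume]
  exact integral_congr_ae (h.mono fun x hx => by simp only [hx])

theorem hasSum_conj_mFourierCoeff_mul {f g : Torus n → ℂ} (hf : MemLp f 2) (hg : MemLp g 2) :
    HasSum (fun ν => (starRingEnd ℂ) (mFourierCoeff f ν) * mFourierCoeff g ν)
      (∫ x, (starRingEnd ℂ) (f x) * g x) := by
  have hfa := hf.coeFn_toLp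
  have hga := hg.coeFn_toLp
  have hint : ∫ x, (starRingEnd ℂ) (f x) * g x =
      ∫ x, (starRingEnd ℂ) (hf.toLp f x) * hg.toLp g x := by
    refine integral_congr_ae ?_
    filter_upwards [hfa, hga] with x h1 h2
    rw [h1, h2]
  rw [hint]
  simp only [← mFourierCoeff_congr_ae hfa, ← mFourierCoeff_congr_ae hga]
  -- The `L²` classes are generalized so that `volume` can be replaced by the product of the
  -- measures `haarAddCircle`, for which Parseval's identity is stated.
  revert hint hfa hga
  generalize hf.toLp f = f'
  generalize hg.toLp g = g'
  clear hf hg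
  intro _ _ _
  revert f' g'
  rw [← pi_haarAddCircle]
  intros
  exact hasSum_prod_mFourierCoeff _ _

theorem summable_sq_mFourierCoeff {f : Torus n → ℂ} (hf : MemLp f 2) :
    Summable fun ν => ‖mFourierCoeff f ν‖ ^ 2 := by
  have := (Complex.hasSum_re (hasSum_conj_mFourierCoeff_mul hf hf)).summable
  refine this.congr fun ν => ?_
  rw [Complex.conj_mul']
  norm_cast

theorem exists_memLp_mFourierCoeff_eq {p : (Fin n → ℤ) → ℂ} (hp : Summable fun ν => ‖p ν‖ ^ 2) :
    ∃ f : Torus n → ℂ, MemLp f 2 ∧ ∀ ν, mFourierCoeff f ν = p ν := by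
  have hmem : Memℓp p 2 := memℓp_gen (by simpa using hp)
  rw [← pi_haarAddCircle]
  let h := (mFourierBasis (d := Fin n)).repr.symm ⟨p, hmem⟩
  refine ⟨h, Lp.memLp h, fun ν => ?_⟩
  rw [← mFourierBasis_repr]
  simp [h]

theorem integrable_of_memLp_two {f : Torus n → ℂ} (hf : MemLp f 2) : Integrable f :=
  hf.integrable (by norm_num)

/-- Riesz–Fischer provides an `L²` function with the same coefficients, and uniqueness identifies it
with `f`. -/
theorem memLp_two_of_summable {f : Torus n → ℂ} (hf : Integrable f)
    (hs : Summable fun ν => ‖mFourierCoeff f ν‖ ^ 2) : MemLp f 2 := by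
  obtain ⟨h, hh, hc⟩ := exists_memLp_mFourierCoeff_eq hs
  have hi := integrable_of_memLp_two hh
  have : (fun x => f x - h x) =ᵐ[volume] 0 := by
    refine ae_eq_zero_of_mFourierCoeff_eq_zero (hf.sub hi) fun ν => ?_
    have := hc ν
    simp only [mFourierCoeff_eq_integral_volume, mul_sub] at this ⊢
    rw [integral_sub (integrable_mFourier_mul hf _) (integrable_mFourier_mul hi _), this, sub_self]
  refine (memLp_congr_ae (this.mono fun x hx => ?_)).2 hh
  exact sub_eq_zero.1 hx

/-- If `f` has nonnegative Fourier coefficients, so has `|f|²`. -/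
theorem mFourierCoeff_norm_sq_nonneg {f : Torus n → ℂ} (hf : MemLp f 2)
    (h0 : ∀ ν, 0 ≤ mFourierCoeff f ν) (ν : Fin n → ℤ) :
    0 ≤ mFourierCoeff (fun x => ((‖f x‖ ^ 2 : ℝ) : ℂ)) ν := by
  have hi := integrable_of_memLp_two hf
  have h1 : MemLp (fun x => mFourier ν x * f x) 2 := by
    refine hf.of_le ((mFourier ν).continuous.aestronglyMeasurable.mul hf.1)
      (ae_of_all _ fun x => ?_)
    rw [norm_mul, norm_mFourier_apply, one_mul]
  have h2 : ∀ μ, mFourierCoeff (fun x => mFourier ν x * f x) μ = mFourierCoeff f (μ - ν) := by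
    intro μ
    simp only [mFourierCoeff_eq_integral_volume, ← mul_assoc, ← mFourier_add, neg_sub]
    rw [show -μ + ν = ν - μ by abel]
  -- By Parseval, the coefficient of `|f|²` at `ν` is the autocorrelation `∑ μ, conj(f̂(μ - ν))
  -- f̂(μ)`.
  have h3 := (hasSum_conj_mFourierCoeff_mul h1 hf).nonneg fun μ => by
    rw [h2]
    exact mul_nonneg (star_nonneg_iff.2 (h0 _)) (h0 _)
  refine h3.trans_eq ?_
  rw [mFourierCoeff_eq_integral_volume]
  refine integral_congr_ae (ae_of_all _ fun x => ?_)
  simp only [map_mul, ← mFourier_neg, mul_assoc]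
  push_cast
  rw [← Complex.conj_mul']

/-! ### Wiener's theorem and the bound for `W_n`. -/

theorem volume_torusCube {δ : ℝ} (hδ : δ < 1 / 2) :
    volume (torusCube n δ) = ENNReal.ofReal (2 * δ) ^ n := by
  have : torusCube n δ = Set.univ.pi fun _ => Metric.closedBall (0 : UnitAddCircle) δ := by
    ext x; simp [mem_torusCube hδ]
  rw [this, volume_pi_pi]
  simp only [AddCircle.volume_closedBall, Finset.prod_const, Finset.card_univ, Fintype.card_fin]
  rw [min_eq_right (by linarith)]

theorem norm_prod_apply_le_one {g : C(UnitAddCircle, ℂ)} (hg : ∀ ν, 0 ≤ coeffL ν g) (hg1 : g 0 = 1)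
    (x : Torus n) : ‖∏ i, g (x i)‖ ≤ 1 := by
  rw [norm_prod]
  refine Finset.prod_le_one (fun _ _ => norm_nonneg _) fun i _ => ?_
  simpa [hg1] using norm_apply_le hg (x i)

theorem prod_apply_eq_zero {δ : ℝ} (hδ : δ < 1 / 2) {g : C(UnitAddCircle, ℂ)} (hg : Feasible δ g)
    {x : Torus n} (hx : x ∉ torusCube n δ) : ∏ i, g (x i) = 0 := by
  rw [mem_torusCube hδ] at hx
  push Not at hx
  obtain ⟨i, hi⟩ := hx
  exact Finset.prod_eq_zero (Finset.mem_univ i) (hg.eq_zero _ hi)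

theorem measurableSet_torusCube {δ : ℝ} (hδ : δ < 1 / 2) : MeasurableSet (torusCube n δ) :=
  (isClosed_torusCube hδ).measurableSet

theorem enorm_sq_eq_ofReal (z : ℂ) : ‖z‖ₑ ^ 2 = ENNReal.ofReal (‖z‖ ^ 2) := by
  rw [ENNReal.ofReal_pow (norm_nonneg _), ofReal_norm]

theorem memLp_two_iff_lintegral {μ : Measure (Torus n)} {f : Torus n → ℂ}
    (hf : AEStronglyMeasurable f μ) : MemLp f 2 μ ↔ ∫⁻ x, ‖f x‖ₑ ^ 2 ∂μ < ∞ := by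
  rw [MemLp, and_iff_right hf, eLpNorm_lt_top_iff_lintegral_rpow_enorm_lt_top (by simp) (by simp)]
  simp

/-- Wiener's theorem: a function with nonnegative Fourier coefficients which is square integrable
near the origin is square integrable. -/
theorem memLp_two_of_setLIntegral {δ : ℝ} (h0 : 0 < δ) (hδ : δ < 1 / 2) {f : Torus n → ℂ}
    (hf : IsL1Plus f) (hD : ∫⁻ x in torusCube n δ, ‖f x‖ₑ ^ 2 < ∞) : MemLp f 2 := by
  -- Any admissible `g` with positive mean serves here: `f ∏ g` is in `L²`, and its coefficients
  -- dominate a positive multiple of those of `f`.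
  obtain ⟨g, hgp, hg, hg1, hg0⟩ := exists_feasible_gt hδ le_rfl (h0.trans_le (le_turan h0 hδ))
  obtain ⟨hi, hle⟩ := le_mFourierCoeff_mul_prod hf.1 hf.2 hgp Finset.univ
  set G : Torus n → ℂ := fun x => f x * ∏ i, g (x i) with hG
  have hG2 : MemLp G 2 := by
    rw [memLp_two_iff_lintegral hi.aestronglyMeasurable]
    refine lt_of_le_of_lt ?_ hD
    rw [← lintegral_indicator (measurableSet_torusCube hδ)]
    refine lintegral_mono fun x => ?_
    by_cases hx : x ∈ torusCube n δ
    · rw [indicator_of_mem hx, enorm_sq_eq_ofReal, enorm_sq_eq_ofReal]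
      refine ENNReal.ofReal_le_ofReal ?_
      gcongr
      rw [hG, norm_mul]
      exact mul_le_of_le_one_right (norm_nonneg _) (norm_prod_apply_le_one hgp hg1 x)
    · simp [hG, prod_apply_eq_zero hδ hg hx]
  refine memLp_two_of_summable hf.1 ?_
  have hc : (0 : ℝ) < ‖coeffL 0 g ^ n‖ := by
    rw [norm_pos_iff]
    refine pow_ne_zero _ fun h => ?_
    rw [h] at hg0; simp at hg0
  refine Summable.of_nonneg_of_le (fun _ => by positivity) (fun ν => ?_)
    ((summable_sq_mFourierCoeff hG2).mul_left ((‖coeffL 0 g ^ n‖ ^ 2)⁻¹))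
  rw [le_inv_mul_iff₀ (by positivity), ← mul_pow, ← norm_mul]
  gcongr
  have h1 := hle ν
  rw [Finset.card_univ, Fintype.card_fin] at h1
  have h2 := mul_nonneg (pow_nonneg (hgp 0) n) (hf.2 ν)
  have h3 := (Complex.le_def.1 h1).1
  rwa [Complex.re_eq_norm.2 h2, Complex.re_eq_norm.2 (h2.trans h1)] at h3

/-- Apply the coefficient bound to `|f|²` at frequency `0`, then use that `∏ g` vanishes off the
cube and has modulus at most `1`. -/
theorem pow_mul_integral_le {δ : ℝ} (hδ : δ < 1 / 2) {f : Torus n → ℂ}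
    (hf : IsL1Plus f) (hf2 : MemLp f 2) {g : C(UnitAddCircle, ℂ)} (hgp : ∀ ν, 0 ≤ coeffL ν g)
    (hg : Feasible δ g) (hg1 : g 0 = 1) :
    (coeffL 0 g).re ^ n * ∫ x, ‖f x‖ ^ 2 ≤ ∫ x in torusCube n δ, ‖f x‖ ^ 2 := by
  have hint : Integrable fun x => ‖f x‖ ^ 2 := hf2.integrable_norm_pow (by norm_num)
  have hintC : Integrable fun x => ((‖f x‖ ^ 2 : ℝ) : ℂ) := hint.ofReal
  obtain ⟨hi, hle⟩ := le_mFourierCoeff_mul_prod hintC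
    (mFourierCoeff_norm_sq_nonneg hf2 hf.2) hgp Finset.univ
  have h1 := (Complex.le_def.1 (hle 0)).1
  have hc : coeffL 0 g = ((coeffL 0 g).re : ℂ) :=
    Complex.eq_re_of_ofReal_le (r := 0) (by simpa using hgp 0)
  rw [hc, mFourierCoeff_eq_integral_volume, mFourierCoeff_eq_integral_volume] at h1
  simp only [neg_zero, mFourier_zero, ContinuousMap.one_apply, one_mul, Finset.card_univ,
    Fintype.card_fin] at h1
  rw [integral_complex_ofReal, ← Complex.ofReal_pow, ← Complex.ofReal_mul, Complex.ofReal_re] at h1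
  refine h1.trans ((Complex.re_le_norm _).trans ?_)
  rw [← integral_indicator (measurableSet_torusCube hδ)]
  refine norm_integral_le_of_norm_le (hint.indicator (measurableSet_torusCube hδ))
    (ae_of_all _ fun x => ?_)
  by_cases hx : x ∈ torusCube n δ
  · rw [indicator_of_mem hx, norm_mul, Complex.norm_real, Real.norm_of_nonneg (by positivity)]
    exact mul_le_of_le_one_right (by positivity) (norm_prod_apply_le_one hgp hg1 x)
  · simp [prod_apply_eq_zero hδ hg hx, hx]

theorem ofReal_turan_pow_mul_le {δ : ℝ} (h0 : 0 < δ) (hδ : δ < 1 / 2) {f : Torus n → ℂ}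
    (hf : IsL1Plus f) (hD : ∫⁻ x in torusCube n δ, ‖f x‖ₑ ^ 2 < ∞) :
    ENNReal.ofReal (turan δ ^ n) * ∫⁻ x, ‖f x‖ₑ ^ 2 ≤ ∫⁻ x in torusCube n δ, ‖f x‖ₑ ^ 2 := by
  have hf2 := memLp_two_of_setLIntegral h0 hδ hf hD
  have hint : Integrable fun x => ‖f x‖ ^ 2 := hf2.integrable_norm_pow (by norm_num)
  have ht : 0 < turan δ := h0.trans_le (le_turan h0 hδ)
  simp only [enorm_sq_eq_ofReal]
  rw [← ofReal_integral_eq_lintegral_ofReal hint (ae_of_all _ fun x => by positivity),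
    ← ofReal_integral_eq_lintegral_ofReal hint.integrableOn (ae_of_all _ fun x => by positivity),
    ← ENNReal.ofReal_mul (by positivity)]
  refine ENNReal.ofReal_le_ofReal ?_
  -- Every `c` below the Turán constant is exceeded by the mean of some admissible `g`, so the bound
  -- holds with `c` in its place; let `c` increase to it. No extremal function is needed.
  have hlim : Tendsto (fun c : ℝ => c ^ n * ∫ x, ‖f x‖ ^ 2) (𝓝[<] turan δ)
      (𝓝 (turan δ ^ n * ∫ x, ‖f x‖ ^ 2)) :=
    (Continuous.tendsto (by fun_prop) _).mono_left nhdsWithin_le_nhds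
  refine le_of_tendsto hlim ?_
  filter_upwards [Ico_mem_nhdsLT ht] with c hc
  obtain ⟨g, hgp, hg, hg1, hg0⟩ := exists_feasible_gt hδ hc.1 hc.2
  refine le_trans ?_ (pow_mul_integral_le hδ hf hf2 hgp hg hg1)
  have : 0 ≤ ∫ x, ‖f x‖ ^ 2 := integral_nonneg fun x => by positivity
  have hc0 := hc.1
  gcongr

theorem wienerConst_torusCube_le {δ : ℝ} (h0 : 0 < δ) (hδ : δ < 1 / 2) :
    wienerConst n (torusCube n δ) ≤ ENNReal.ofReal ((2 : ℝ) ^ n * (1 - theta δ) ^ n) := by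
  have ht : 0 < turan δ := h0.trans_le (le_turan h0 hδ)
  have e : (2 : ℝ) ^ n * (1 - theta δ) ^ n = (2 * δ) ^ n / turan δ ^ n := by
    rw [theta, sub_sub_cancel, ← mul_pow, ← div_pow]; ring
  rw [e]
  refine iSup_le fun f => iSup_le fun hf => iSup_le fun _ => ?_
  have hv := volume_torusCube (n := n) hδ
  rw [← ENNReal.ofReal_pow (by positivity)] at hv
  rw [hv]
  have hp : (0 : ℝ) < (2 * δ) ^ n := by positivity
  have hq : (0 : ℝ) < turan δ ^ n := by positivity
  -- If the integral over the cube is infinite, the quotient is `0` by the convention for division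
  -- by `∞`.
  rcases eq_or_ne (∫⁻ x in torusCube n δ, ‖f x‖ₑ ^ 2) ∞ with hD | hD
  · rw [hD, ENNReal.mul_top (by simp), ENNReal.div_top]
    exact zero_le
  · have h := ofReal_turan_pow_mul_le h0 hδ hf (lt_top_iff_ne_top.2 hD)
    refine ENNReal.div_le_of_le_mul ?_
    calc ∫⁻ x, ‖f x‖ₑ ^ 2 = ENNReal.ofReal ((2 * δ) ^ n / turan δ ^ n) *
          ((ENNReal.ofReal ((2 * δ) ^ n))⁻¹ *
            (ENNReal.ofReal (turan δ ^ n) * ∫⁻ x, ‖f x‖ₑ ^ 2)) := by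
          rw [← ENNReal.ofReal_inv_of_pos hp, ← mul_assoc, ← mul_assoc,
            ← ENNReal.ofReal_mul (by positivity), ← ENNReal.ofReal_mul (by positivity)]
          rw [show (2 * δ) ^ n / turan δ ^ n * ((2 * δ) ^ n)⁻¹ * turan δ ^ n = 1 by field_simp]
          simp
      _ ≤ _ := by gcongr

/-! ### Properties of `θ`. -/

theorem theta_nonneg {δ : ℝ} (h0 : 0 < δ) (h : δ < 1 / 2) : 0 ≤ theta δ :=
  sub_nonneg.2 (div_le_one_of_le₀ (le_turan h0 h) (h0.le.trans (le_turan h0 h)))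

theorem theta_le {δ : ℝ} (h0 : 0 < δ) (h : δ < 1 / 2) : theta δ ≤ 48 * δ ^ 2 := by
  have ht : 0 < turan δ := h0.trans_le (le_turan h0 h)
  have h1 : δ / (δ + 48 * δ ^ 3) ≤ δ / turan δ := by
    gcongr
    exact turan_le_add h0 h
  have h2 : δ / (δ + 48 * δ ^ 3) = 1 - 48 * δ ^ 2 / (1 + 48 * δ ^ 2) := by
    field_simp; ring
  have h3 : 48 * δ ^ 2 / (1 + 48 * δ ^ 2) ≤ 48 * δ ^ 2 :=
    div_le_self (by positivity) (by nlinarith [sq_nonneg δ])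
  unfold theta
  linarith

theorem continuousOn_theta : ContinuousOn theta (Ioo 0 (1 / 2)) :=
  continuousOn_const.sub (continuousOn_id.div continuousOn_turan fun _ hδ =>
    (hδ.1.trans_le (le_turan hδ.1 hδ.2)).ne')

theorem theta_isBigO : theta =O[𝓝[>] (0 : ℝ)] fun δ : ℝ => δ ^ 2 := by
  refine IsBigO.of_bound 48 ?_
  filter_upwards [Ioo_mem_nhdsGT (show (0 : ℝ) < 1 / 2 by norm_num)] with δ hδ
  rw [Real.norm_of_nonneg (theta_nonneg hδ.1 hδ.2), Real.norm_of_nonneg (sq_nonneg δ)]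
  exact theta_le hδ.1 hδ.2

theorem theta_eq_zero {δ : ℝ} (h0 : 0 < δ) (h : δ < 1 / 2) {q : ℕ} (hq : 1 / δ = q) :
    theta δ = 0 := by
  have hq0 : 0 < q := by
    have : (0 : ℝ) < q := by rw [← hq]; positivity
    exact_mod_cast this
  have e : δ = 1 / q := by rw [← hq]; simp
  have h1 := turan_le_of_nat h0 h hq0 e.le
  rw [← e] at h1
  have h2 : turanConst 1 (torusCube 1 δ) = δ := le_antisymm h1 (le_turan h0 h)
  rw [theta, h2, div_self h0.ne', sub_self]

theorem theta_mem_Ioo {δ : ℝ} (h0 : 0 < δ) (h : δ < 1 / 2) (hq : ¬ ∃ q : ℕ, 1 / δ = q) :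
    0 < theta δ ∧ theta δ < 1 := by
  have h1 := lt_turan h0 h hq
  have ht := h0.trans h1
  exact ⟨sub_pos.2 ((div_lt_one ht).2 h1), sub_lt_self _ (div_pos h0 ht)⟩

end WienerTuran

end

theorem theorem2 :
    (∀ n : ℕ, 1 ≤ n → ∀ δ ∈ Ioo (0 : ℝ) (1 / 2),
      WienerTuran.wienerConst n (WienerTuran.torusCube n δ) ≤
        ENNReal.ofReal ((2 : ℝ) ^ n * (1 - WienerTuran.theta δ) ^ n)) ∧
    ContinuousOn WienerTuran.theta (Ioo (0 : ℝ) (1 / 2)) ∧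
    WienerTuran.theta =O[𝓝[>] (0 : ℝ)] (fun δ : ℝ => δ ^ 2) ∧
    (∀ δ ∈ Ioo (0 : ℝ) (1 / 2), (∃ q : ℕ, 1 / δ = (q : ℝ)) → WienerTuran.theta δ = 0) ∧
    (∀ δ ∈ Ioo (0 : ℝ) (1 / 2), (¬ ∃ q : ℕ, 1 / δ = (q : ℝ)) →
      0 < WienerTuran.theta δ ∧ WienerTuran.theta δ < 1) :=
  ⟨fun _ _ _ hδ => WienerTuran.wienerConst_torusCube_le hδ.1 hδ.2,
    WienerTuran.continuousOn_theta, WienerTuran.theta_isBigO,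
    fun _ hδ ⟨_, hq⟩ => WienerTuran.theta_eq_zero hδ.1 hδ.2 hq,
    fun _ hδ hq => WienerTuran.theta_mem_Ioo hδ.1 hδ.2 hq⟩
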